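/- Let $l_x,l_y>0$ and $\Omega=\mathbb T^2_{xy}\times[0,1]_z$, where $\mathbb T^2_{xy}$ is the torus $[0,l_x]\times[0,l_y]$ with opposite sides identified. For a measurable $f\ge 0$ on $(0,\infty)\times\Omega$ put $$\langle f\rangle=\limsup_{\tau\to\infty}\frac1\tau\frac1{|\Omega|}\int_0^\tau\!\!\int_\Omega f(\mathbf x,t)\,d\mathbf x\,dt\in[0,\infty].$$ Let $\mathbf u=(u,v,w)$ be a (time-dependent) divergence-free velocity field on $(0,\infty)\times\Omega$ with $\langle|\mathbf u|^2\rangle<\infty$. Let $T_0\in L^\infty(\Omega)$, and let $T$ be the essentially bounded weak solution, with $\nabla T\in L^2((0,\tau)\times\Omega)$ for every $\tau$, of $$\partial_tT+\mathbf u\cdot\nabla T=\Delta T,\qquad T|_{z=0}=1,\quad T|_{z=1}=0,\quad T|_{t=0}=T_0 .$$ Define the Nusselt number by $Nu(\mathbf u)=\langle|\nabla T|^2\rangle$. **Proposition.** If $w=0$ on $\partial\Omega$ (in the sense of the normal trace of the divergence-free field $\mathbf u$), then, for every such $T_0$ and $T$, $$Nu(\mathbf u)\le 1+\tfrac12\,\langle|w|^2\rangle^{1/2}.$$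 -/

import Mathlib

open MeasureTheory Set Filter Topology
open scoped ENNReal ContDiff Gradient

noncomputable section

namespace WallToWall

/-- Space `ℝ³`; the coordinates `x 0`, `x 1`, `x 2` are written `x`, `y`, `z` in the comments. -/
abbrev Space := EuclideanSpace ℝ (Fin 3)

/-- The unit coordinate vector in direction `i`. -/
def unitVec (i : Fin 3) : Space := EuclideanSpace.single i (1 : ℝ)

/-- The domain `Ω = 𝕋² × [0,1]`, with the torus identified with the cell `[0, lx] × [0, ly]`
(up to a null set). Functions on `Ω` are, up to null sets, functions on this cell;
periodicity enters through the test functions. -/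
def cell (lx ly : ℝ) : Set Space :=
  {x | x 0 ∈ Ioo 0 lx ∧ x 1 ∈ Ioo 0 ly ∧ x 2 ∈ Ioo (0 : ℝ) 1}

/-- Lebesgue measure on `Ω`. -/
def cellMeasure (lx ly : ℝ) : Measure Space := volume.restrict (cell lx ly)

/-- Lebesgue measure on `(0, ∞) × Ω`. -/
def spaceTimeMeasure (lx ly : ℝ) : Measure (ℝ × Space) :=
  (volume.restrict (Ioi (0 : ℝ))).prod (cellMeasure lx ly)

/-- Periodicity in the wall-parallel variables. -/
def IsPeriodic (lx ly : ℝ) (φ : Space → ℝ) : Prop :=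
  ∀ x, φ (x + lx • unitVec 0) = φ x ∧ φ (x + ly • unitVec 1) = φ x

/-- Smooth functions on `𝕋² × [0,1]`, up to the walls, with no condition at the walls. -/
def IsSmoothPeriodic (lx ly : ℝ) (φ : Space → ℝ) : Prop :=
  ContDiff ℝ ∞ φ ∧ IsPeriodic lx ly φ

/-- Vanishing in a neighbourhood of the walls `z = 0` and `z = 1`. -/
def VanishesNearWalls (φ : Space → ℝ) (δ : ℝ) : Prop :=
  ∀ x, x 2 ≤ δ ∨ 1 - δ ≤ x 2 → φ x = 0

/-- Test functions `C_c^∞(Ω)`: smooth, periodic in `x` and `y`, and vanishing near the walls. -/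
def IsTestFunction (lx ly : ℝ) (φ : Space → ℝ) : Prop :=
  IsSmoothPeriodic lx ly φ ∧ ∃ δ > 0, VanishesNearWalls φ δ

/-- Test functions `C_c^∞([0, ∞) × Ω)`: smooth in `(t, x)`, periodic in `x` and `y`, vanishing
near the walls and for large times, but not necessarily at `t = 0`. -/
def IsSpaceTimeTestFunction (lx ly : ℝ) (ψ : ℝ → Space → ℝ) : Prop :=
  ContDiff ℝ ∞ (fun p : ℝ × Space => ψ p.1 p.2) ∧
  (∀ t, IsPeriodic lx ly (ψ t)) ∧
  (∃ δ > 0, ∀ t, VanishesNearWalls (ψ t) δ) ∧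
  (∃ R : ℝ, ∀ t x, R ≤ t → ψ t x = 0)

/-- `θ ∈ H₀¹(Ω)` with weak gradient `g`: the pair `(θ, g)` is the limit in `L²(Ω)` of pairs
`(φₙ, ∇φₙ)` with `φₙ ∈ C_c^∞(Ω)`. -/
def HasH10Gradient (lx ly : ℝ) (θ : Space → ℝ) (g : Space → Space) : Prop :=
  MemLp θ 2 (cellMeasure lx ly) ∧ MemLp g 2 (cellMeasure lx ly) ∧
  ∃ φ : ℕ → Space → ℝ, (∀ n, IsTestFunction lx ly (φ n)) ∧
    Tendsto (fun n => eLpNorm (fun x => φ n x - θ x) 2 (cellMeasure lx ly)) atTop (𝓝 0) ∧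
    Tendsto (fun n => eLpNorm (fun x => ∇ (φ n) x - g x) 2 (cellMeasure lx ly)) atTop (𝓝 0)

/-- The (limit superior) space and long-time average
`⟨f⟩ = limsup_{τ → ∞} ⨍_0^τ ⨍_Ω f dx dt` of a nonnegative function, with values in `[0, ∞]`. -/
def longTimeAverage (lx ly : ℝ) (f : ℝ → Space → ℝ≥0∞) : ℝ≥0∞ :=
  limsup (fun τ : ℝ => ⨍⁻ t in Ioc 0 τ, (⨍⁻ x in cell lx ly, f t x ∂volume) ∂volume) atTop

/-- `div u(t) = 0` in the sense of distributions on `Ω`, for almost every time `t > 0`. -/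
def IsDivFree (lx ly : ℝ) (u : ℝ → Space → Space) : Prop :=
  ∀ᵐ t ∂(volume.restrict (Ioi (0 : ℝ))), ∀ φ, IsTestFunction lx ly φ →
    ∫ x, inner ℝ (u t x) (∇ φ x) ∂(cellMeasure lx ly) = 0

/-- The no-penetration condition `w = 0` on `∂Ω` for a divergence-free square-integrable field:
its normal trace at the walls vanishes. By Green's formula the normal trace of such a field is
the functional `φ ↦ ∫_Ω u · ∇φ` on functions that are smooth up to the walls. -/
def NoPenetration (lx ly : ℝ) (u : ℝ → Space → Space) : Prop :=
  ∀ᵐ t ∂(volume.restrict (Ioi (0 : ℝ))), ∀ φ, IsSmoothPeriodic lx ly φ →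
    ∫ x, inner ℝ (u t x) (∇ φ x) ∂(cellMeasure lx ly) = 0

/-- `T` is an essentially bounded weak solution, with weak spatial gradient `G = ∇T`, of
`∂ₜT + u · ∇T = ΔT` on `(0, ∞) × Ω`, with `T = 1` at `z = 0`, `T = 0` at `z = 1`, and
`T = T₀` at `t = 0`, for a divergence-free velocity field `u`. -/
structure IsWeakSolution (lx ly : ℝ) (u : ℝ → Space → Space) (T₀ : Space → ℝ)
    (T : ℝ → Space → ℝ) (G : ℝ → Space → Space) : Prop where
  /-- `T` is measurable and essentially bounded. -/
  bounded : MemLp (fun p : ℝ × Space => T p.1 p.2) ⊤ (spaceTimeMeasure lx ly)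
  /-- `∇T` is measurable. -/
  grad_meas : AEStronglyMeasurable (fun p : ℝ × Space => G p.1 p.2) (spaceTimeMeasure lx ly)
  /-- `∇T ∈ L²((0, τ) × Ω)` for every `τ`. -/
  grad_sq : ∀ τ : ℝ, ∫⁻ t in Ioc 0 τ, ∫⁻ x, ‖G t x‖ₑ ^ 2 ∂(cellMeasure lx ly) < ⊤
  /-- `T(t) - (1 - z) ∈ H₀¹(Ω)`, with gradient `∇T(t) + e_z`, for almost every `t > 0`: this is
  the Dirichlet boundary condition, together with the fact that `G` is the gradient of `T`. -/
  dirichlet : ∀ᵐ t ∂(volume.restrict (Ioi (0 : ℝ))),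
    HasH10Gradient lx ly (fun x => T t x - (1 - x 2)) (fun x => G t x + unitVec 2)
  /-- The equation and the initial condition, in weak form. -/
  weak_form : ∀ ψ, IsSpaceTimeTestFunction lx ly ψ →
    (∫ t in Ioi (0 : ℝ), ∫ x, (T t x * deriv (fun s => ψ s x) t
        + T t x * inner ℝ (u t x) (∇ (ψ t) x)
        - inner ℝ (G t x) (∇ (ψ t) x)) ∂(cellMeasure lx ly))
      + ∫ x, T₀ x * ψ 0 x ∂(cellMeasure lx ly) = 0

/-- The Nusselt number `⟨|∇T|²⟩`, where `G = ∇T`. -/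
def nusselt (lx ly : ℝ) (G : ℝ → Space → Space) : ℝ≥0∞ :=
  longTimeAverage lx ly (fun t x => ‖G t x‖ₑ ^ 2)

end WallToWall

end

/-! Testing the equation with `T - (1 - z)`, which vanishes at the walls, gives the energy
inequality. Since `u` is divergence free with no flux through the walls, `∫ u · ∇B(T) = 0` for every
smooth `B`. Hence the dissipation over `(1, τ)` is at most `(τ - 1)|Ω| + ∫∫ T w` plus a constant
independent of `τ`. Also `∫ w = 0`, so `T` may be replaced by `T - 1/2` (`exists_bound_energy`). If
`0 ≤ T ≤ 1`, then `|T - 1/2| ≤ 1/2`, and Cauchy–Schwarz produces the factor `1/2`.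

The data `T₀` are only bounded, so the range `[0, 1]` is reached only asymptotically. Let `γ` be
smooth, nondecreasing and zero exactly on `[0, 1]`. Testing with `γ(T)`, which lies in `H₀¹`, bounds
`∫∫ γ'(T)|∇T|²` uniformly in `τ`; Poincaré then bounds `∫∫ γ(T)²` uniformly
(`exists_bound_barrier`). Since `|T - 1/2| ≤ 1/2 + ε + K|γ(T)|`, the excess outside `[0, 1]` costs,
after Young's inequality, a bounded term and terms of size `ε`. Dividing by `τ` and letting `ε → 0`
gives the claim.

Both tests are instances of one inequality, for a convex `j` and the test function `j'(T) - j'(1 -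
z)` (`exists_bound_integral_flux`). It replaces the chain rule in time, which the weak solution does
not directly provide: backward increments `T(s) - T(s - h)` are paired with the test function at
time `s`, convexity bounds the pairing from below by an increment of a bounded functional, and `h →
0` uses continuity of translations in `L²`. The admissibility of the test function is the chain rule
in `H₀¹` (`HasH10Gradient.comp`). -/

namespace WallToWall

/-! ### Convergence of pairings in `L²`. -/

section L2

set_option linter.unusedSectionVars false

variable {α E : Type*} [MeasurableSpace α] {μ : Measure α}
  [NormedAddCommGroup E] [InnerProductSpace ℝ E]

lemma integrable_inner_of_memLp {f g : α → E} (hf : MemLp f 2 μ) (hg : MemLp g 2 μ) :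
    Integrable (fun x => inner ℝ (f x) (g x)) μ := by
  refine (L2.integrable_inner (𝕜 := ℝ) (hf.toLp f) (hg.toLp g)).congr ?_
  filter_upwards [hf.coeFn_toLp, hg.coeFn_toLp] with x h1 h2
  rw [h1, h2]

lemma inner_toLp_eq_integral {f g : α → E} (hf : MemLp f 2 μ) (hg : MemLp g 2 μ) :
    inner ℝ (hf.toLp f) (hg.toLp g) = ∫ x, inner ℝ (f x) (g x) ∂μ := by
  rw [L2.inner_def]
  refine integral_congr_ae ?_
  filter_upwards [hf.coeFn_toLp, hg.coeFn_toLp] with x h1 h2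
  rw [h1, h2]

lemma tendsto_toLp {ι : Type*} {l : Filter ι} {f : ι → α → E} {g : α → E}
    (hf : ∀ n, MemLp (f n) 2 μ) (hg : MemLp g 2 μ)
    (h : Tendsto (fun n => eLpNorm (fun x => f n x - g x) 2 μ) l (𝓝 0)) :
    Tendsto (fun n => (hf n).toLp (f n)) l (𝓝 (hg.toLp g)) :=
  (Lp.tendsto_Lp_iff_tendsto_eLpNorm'' f hf g hg).2 h

lemma tendsto_integral_inner {ι : Type*} {l : Filter ι} {f : ι → α → E} {g q : α → E}
    (hq : MemLp q 2 μ) (hf : ∀ n, MemLp (f n) 2 μ) (hg : MemLp g 2 μ)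
    (h : Tendsto (fun n => eLpNorm (fun x => f n x - g x) 2 μ) l (𝓝 0)) :
    Tendsto (fun n => ∫ x, inner ℝ (q x) (f n x) ∂μ) l (𝓝 (∫ x, inner ℝ (q x) (g x) ∂μ)) := by
  have := (tendsto_const_nhds (x := hq.toLp q)).inner (𝕜 := ℝ) (tendsto_toLp hf hg h)
  simpa only [inner_toLp_eq_integral] using this

lemma tendsto_integral_mul {ι : Type*} {l : Filter ι} {f : ι → α → ℝ} {g q : α → ℝ}
    (hq : MemLp q 2 μ) (hf : ∀ n, MemLp (f n) 2 μ) (hg : MemLp g 2 μ)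
    (h : Tendsto (fun n => eLpNorm (fun x => f n x - g x) 2 μ) l (𝓝 0)) :
    Tendsto (fun n => ∫ x, q x * f n x ∂μ) l (𝓝 (∫ x, q x * g x ∂μ)) := by
  have := tendsto_integral_inner hq hf hg h
  simpa only [RCLike.inner_apply, conj_trivial, mul_comm] using this

lemma tendsto_integral_norm_sq {ι : Type*} {l : Filter ι} {f : ι → α → E} {g : α → E}
    (hf : ∀ n, MemLp (f n) 2 μ) (hg : MemLp g 2 μ)
    (h : Tendsto (fun n => eLpNorm (fun x => f n x - g x) 2 μ) l (𝓝 0)) :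
    Tendsto (fun n => ∫ x, ‖f n x‖ ^ 2 ∂μ) l (𝓝 (∫ x, ‖g x‖ ^ 2 ∂μ)) := by
  have := (tendsto_toLp hf hg h).inner (𝕜 := ℝ) (tendsto_toLp hf hg h)
  simp only [inner_toLp_eq_integral] at this
  simpa only [real_inner_self_eq_norm_sq] using this

end L2

/-! ### The cell, and integration by parts in the vertical direction. -/

lemma measurableSet_cell (lx ly : ℝ) : MeasurableSet (cell lx ly) := by
  unfold cell
  have (i : Fin 3) : Measurable fun x : Space => x i := by fun_prop
  exact ((this 0) measurableSet_Ioo).inter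
    (((this 1) measurableSet_Ioo).inter ((this 2) measurableSet_Ioo))

lemma isOpen_cell (lx ly : ℝ) : IsOpen (cell lx ly) := by
  unfold cell
  have (i : Fin 3) : Continuous fun x : Space => x i := by fun_prop
  exact (isOpen_Ioo.preimage (this 0)).inter
    ((isOpen_Ioo.preimage (this 1)).inter (isOpen_Ioo.preimage (this 2)))

/-- The upper corner of the box of coordinates of the cell; the lower corner is `0`. -/
def boxTop (lx ly : ℝ) : Fin 3 → ℝ := ![lx, ly, 1]

lemma cell_eq_preimage (lx ly : ℝ) :
    cell lx ly = (MeasurableEquiv.toLp 2 (Fin 3 → ℝ)).symm ⁻¹'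
      (Set.pi univ fun i => Ioo ((0 : Fin 3 → ℝ) i) (boxTop lx ly i)) := by
  ext x
  simp [cell, Set.mem_pi, Fin.forall_fin_succ, boxTop]

lemma isCompact_closedBox (lx ly : ℝ) :
    IsCompact ((MeasurableEquiv.toLp 2 (Fin 3 → ℝ)).symm ⁻¹' (Icc 0 (boxTop lx ly))) := by
  have := (isCompact_Icc (a := (0 : Fin 3 → ℝ)) (b := boxTop lx ly))
  exact (EuclideanSpace.equiv (Fin 3) ℝ).toHomeomorph.isCompact_preimage.2 this

lemma cell_subset_closedBox (lx ly : ℝ) :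
    cell lx ly ⊆ (MeasurableEquiv.toLp 2 (Fin 3 → ℝ)).symm ⁻¹' (Icc 0 (boxTop lx ly)) := by
  rw [cell_eq_preimage]
  refine preimage_mono fun x hx => ⟨fun i => (hx i trivial).1.le, fun i => (hx i trivial).2.le⟩

lemma volume_cell_lt_top (lx ly : ℝ) : volume (cell lx ly) < ⊤ :=
  (measure_mono (cell_subset_closedBox lx ly)).trans_lt (isCompact_closedBox lx ly).measure_lt_top

instance isFiniteMeasure_cellMeasure (lx ly : ℝ) : IsFiniteMeasure (cellMeasure lx ly) := by
  unfold cellMeasure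
  exact ⟨by simpa using volume_cell_lt_top lx ly⟩

lemma volume_cell_pos {lx ly : ℝ} (hlx : 0 < lx) (hly : 0 < ly) : 0 < volume (cell lx ly) := by
  refine (isOpen_cell lx ly).measure_pos _ ⟨WithLp.toLp 2 ![lx / 2, ly / 2, 1 / 2], ?_⟩
  simp [cell]
  refine ⟨?_, ?_, ?_⟩ <;> linarith

lemma ae_mem_cell (lx ly : ℝ) : ∀ᵐ x ∂(cellMeasure lx ly), x ∈ cell lx ly :=
  ae_restrict_mem (measurableSet_cell lx ly)

lemma memLp_of_continuous {E : Type*} [NormedAddCommGroup E]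
    {f : Space → E} (hf : Continuous f) (p : ℝ≥0∞) (lx ly : ℝ) : MemLp f p (cellMeasure lx ly) := by
  obtain ⟨C, hC⟩ := (isCompact_closedBox lx ly).exists_bound_of_continuousOn hf.continuousOn
  refine MemLp.of_bound hf.aestronglyMeasurable C ?_
  filter_upwards [ae_mem_cell lx ly] with x hx using hC x (cell_subset_closedBox lx ly hx)

/-- The divergence theorem is applied to the vertical field `ψ e_z`. Its flux through the lateral
faces is zero, so no periodicity is needed. -/
lemma integral_partial_eq_zero {lx ly : ℝ} (hlx : 0 < lx) (hly : 0 < ly) {ψ : Space → ℝ}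
    (hψ : ContDiff ℝ 1 ψ) (h0 : ∀ x : Space, x 2 = 0 → ψ x = 0) (h1 : ∀ x : Space, x 2 = 1 → ψ x = 0) :
    ∫ x, fderiv ℝ ψ x (unitVec 2) ∂(cellMeasure lx ly) = 0 := by
  set e := EuclideanSpace.equiv (Fin 3) ℝ with he
  have hmp := (EuclideanSpace.volume_preserving_symm_measurableEquiv_toLp (Fin 3))
  have hS : cell lx ly = (MeasurableEquiv.toLp 2 (Fin 3 → ℝ)).symm ⁻¹'
      (Set.pi univ fun i => Ioo ((0 : Fin 3 → ℝ) i) (boxTop lx ly i)) := cell_eq_preimage lx ly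
  let F : (Fin 3 → ℝ) → ℝ := fun y => ψ (e.symm y)
  have hF : ContDiff ℝ 1 F := hψ.comp e.symm.contDiff
  have hFd : ∀ y, fderiv ℝ F y (Pi.single 2 1) = fderiv ℝ ψ (e.symm y) (unitVec 2) := by
    intro y
    have : HasFDerivAt F ((fderiv ℝ ψ (e.symm y)).comp (e.symm : (Fin 3 → ℝ) →L[ℝ] Space)) y :=
      ((hψ.differentiable (by simp)) _).hasFDerivAt.comp y e.symm.hasFDerivAt
    rw [this.fderiv]
    rfl
  have hdiv := integral_divergence_of_hasFDerivAt_off_countable' (n := 2) (E := ℝ)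
    (0 : Fin 3 → ℝ) (boxTop lx ly)
    (by intro i; fin_cases i <;> simp [boxTop, hlx.le, hly.le])
    (fun i y => if i = 2 then F y else 0) (fun i y => if i = 2 then fderiv ℝ F y else 0) ∅
    countable_empty
    (by
      intro i
      by_cases hi : i = 2
      · simpa [hi] using hF.continuous.continuousOn
      · simpa [hi] using continuousOn_const)
    (by
      intro y _ i
      by_cases hi : i = 2
      · simpa [hi] using (hF.differentiable (by simp) y).hasFDerivAt
      · simpa [hi] using hasFDerivAt_const _ _)
    (by
      have hc : Continuous fun y => fderiv ℝ F y (Pi.single 2 1) :=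
        (hF.continuous_fderiv (by simp)).clm_apply continuous_const
      refine (hc.continuousOn.integrableOn_compact isCompact_Icc).congr_fun ?_ measurableSet_Icc
      intro y _
      simp [Fin.sum_univ_three])
  have hz : ∀ t : ℝ, (t = 0 ∨ t = 1) → ∀ y : Fin 2 → ℝ, F (Fin.insertNth 2 t y) = 0 := by
    intro t ht y
    rcases ht with rfl | rfl
    · exact h0 _ (by simp [he, EuclideanSpace.equiv])
    · exact h1 _ (by simp [he, EuclideanSpace.equiv])
  have key : ∫ y in Set.pi univ fun i => Ioo ((0 : Fin 3 → ℝ) i) (boxTop lx ly i),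
      fderiv ℝ F y (Pi.single 2 1) = 0 := by
    have hae : (Set.pi univ fun i => Ioo ((0 : Fin 3 → ℝ) i) (boxTop lx ly i)) =ᵐ[volume]
        Icc (0 : Fin 3 → ℝ) (boxTop lx ly) := Measure.univ_pi_Ioo_ae_eq_Icc
    rw [setIntegral_congr_set hae]
    refine Eq.trans ?_ (hdiv.trans ?_)
    · simp [Fin.sum_univ_three]
    · rw [Fin.sum_univ_three]
      have a1 : boxTop lx ly 2 = 1 := by simp [boxTop]
      simp [a1, hz 0 (Or.inl rfl), hz 1 (Or.inr rfl)]
  rw [← key, cellMeasure, hS]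
  have := hmp.setIntegral_preimage_emb (MeasurableEquiv.measurableEmbedding _)
    (fun y => fderiv ℝ F y (Pi.single 2 1))
    (Set.pi univ fun i => Ioo ((0 : Fin 3 → ℝ) i) (boxTop lx ly i))
  rw [← this]
  simp only [hFd]
  rfl

variable {lx ly : ℝ}

/-! ### Test functions and `H₀¹`: orthogonality, Poincaré, separability. -/

lemma unitVec_apply (i j : Fin 3) : unitVec i j = if j = i then 1 else 0 := by
  simp [unitVec]

lemma inner_unitVec (v : Space) (i : Fin 3) : inner ℝ v (unitVec i) = v i := by
  simp [unitVec, EuclideanSpace.inner_single_right]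

lemma norm_unitVec (i : Fin 3) : ‖unitVec i‖ = 1 := by simp [unitVec]

lemma continuous_gradient {φ : Space → ℝ} (h : ContDiff ℝ 1 φ) : Continuous (∇ φ) :=
  (InnerProductSpace.toDual ℝ Space).symm.continuous.comp (h.continuous_fderiv (by simp))

lemma fderiv_unitVec_eq_inner (φ : Space → ℝ) (x : Space) (i : Fin 3) :
    fderiv ℝ φ x (unitVec i) = inner ℝ (∇ φ x) (unitVec i) := by
  rw [inner_gradient_left]

lemma IsTestFunction.contDiff {φ : Space → ℝ} (h : IsTestFunction lx ly φ) (n : ℕ∞) :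
    ContDiff ℝ n φ := h.1.1.of_le (by exact_mod_cast le_top)

lemma IsTestFunction.continuous {φ : Space → ℝ} (h : IsTestFunction lx ly φ) : Continuous φ :=
  (h.contDiff 1).continuous

lemma IsTestFunction.continuous_gradient {φ : Space → ℝ} (h : IsTestFunction lx ly φ) :
    Continuous (∇ φ) := WallToWall.continuous_gradient (h.contDiff 1)

lemma IsTestFunction.eq_zero {φ : Space → ℝ} (h : IsTestFunction lx ly φ) {x : Space}
    (hx : x 2 = 0 ∨ x 2 = 1) : φ x = 0 := by
  obtain ⟨-, δ, hδ, h⟩ := h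
  refine h x ?_
  rcases hx with hx | hx
  · exact Or.inl (by linarith)
  · exact Or.inr (by linarith)

lemma HasH10Gradient.congr {θ θ' : Space → ℝ} {g g' : Space → Space}
    (h : HasH10Gradient lx ly θ g) (hθ : θ =ᵐ[cellMeasure lx ly] θ')
    (hg : g =ᵐ[cellMeasure lx ly] g') : HasH10Gradient lx ly θ' g' := by
  obtain ⟨h1, h2, φ, h3, h4, h5⟩ := h
  refine ⟨(memLp_congr_ae hθ).1 h1, (memLp_congr_ae hg).1 h2, φ, h3, ?_, ?_⟩
  · refine h4.congr fun n => eLpNorm_congr_ae ?_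
    filter_upwards [hθ] with x hx
    rw [hx]
  · refine h5.congr fun n => eLpNorm_congr_ae ?_
    filter_upwards [hg] with x hx
    rw [hx]

lemma HasH10Gradient.integral_inner_eq_zero {θ : Space → ℝ} {g q : Space → Space}
    (h : HasH10Gradient lx ly θ g) (hq : MemLp q 2 (cellMeasure lx ly))
    (hz : ∀ φ, IsTestFunction lx ly φ → ∫ x, inner ℝ (q x) (∇ φ x) ∂(cellMeasure lx ly) = 0) :
    ∫ x, inner ℝ (q x) (g x) ∂(cellMeasure lx ly) = 0 := by
  obtain ⟨h1, h2, φ, h3, h4, h5⟩ := h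
  have := tendsto_integral_inner hq
    (fun n => memLp_of_continuous (h3 n).continuous_gradient 2 lx ly) h2 h5
  simp only [hz _ (h3 _)] at this
  exact tendsto_nhds_unique this tendsto_const_nhds

lemma HasH10Gradient.integral_vertical_eq_zero (hlx : 0 < lx) (hly : 0 < ly) {θ : Space → ℝ}
    {g : Space → Space} (h : HasH10Gradient lx ly θ g) :
    ∫ x, g x 2 ∂(cellMeasure lx ly) = 0 := by
  have := h.integral_inner_eq_zero (q := fun _ => unitVec 2)
    (memLp_of_continuous continuous_const 2 lx ly) (fun φ hφ => by
      have := integral_partial_eq_zero hlx hly (hφ.contDiff 1)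
        (fun x hx => hφ.eq_zero (Or.inl hx)) (fun x hx => hφ.eq_zero (Or.inr hx))
      simpa only [fderiv_unitVec_eq_inner, real_inner_comm] using this)
  simpa only [real_inner_comm, inner_unitVec] using this

/-- With `D = ∂_z(z φ²) = φ² + 2 z φ ∂_zφ`, whose integral is zero, the constant 4 comes from `2D +
4|∂_zφ|² - φ² ≥ (φ + 2z ∂_zφ)² ≥ 0`, valid because `z² ≤ 1`. -/
lemma IsTestFunction.poincare (hlx : 0 < lx) (hly : 0 < ly) {φ : Space → ℝ}
    (hφ : IsTestFunction lx ly φ) :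
    ∫ x, ‖φ x‖ ^ 2 ∂(cellMeasure lx ly) ≤ 4 * ∫ x, ‖∇ φ x‖ ^ 2 ∂(cellMeasure lx ly) := by
  set D : Space → ℝ := fun x => φ x ^ 2 + 2 * x 2 * φ x * fderiv ℝ φ x (unitVec 2) with hD
  have hd : ∀ x, HasFDerivAt φ (fderiv ℝ φ x) x := fun x =>
    ((hφ.contDiff 1).differentiable (by simp) x).hasFDerivAt
  have hz : ∀ x : Space, HasFDerivAt (fun x : Space => x 2)
      (EuclideanSpace.proj 2 : Space →L[ℝ] ℝ) x := fun x =>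
    (EuclideanSpace.proj 2 : Space →L[ℝ] ℝ).hasFDerivAt
  have hcont : Continuous fun x : Space => fderiv ℝ φ x (unitVec 2) :=
    ((hφ.contDiff 1).continuous_fderiv (by simp)).clm_apply continuous_const
  have hDc : Continuous D := by
    have := hφ.continuous
    have h2 : Continuous fun x : Space => x 2 := by fun_prop
    fun_prop
  have h0 : ∫ x, D x ∂(cellMeasure lx ly) = 0 := by
    have := integral_partial_eq_zero (lx := lx) (ly := ly) hlx hly
      (ψ := fun x => x 2 * φ x ^ 2)
      (((EuclideanSpace.proj 2 : Space →L[ℝ] ℝ).contDiff).mul ((hφ.contDiff 1).pow 2))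
      (fun x hx => by simp [hx]) (fun x hx => by simp [hφ.eq_zero (Or.inr hx)])
    rw [← this]
    refine integral_congr_ae (Eventually.of_forall fun x => ?_)
    have hx : fderiv ℝ (fun x : Space => x 2 * φ x ^ 2) x = _ :=
      ((hz x).mul ((hd x).pow 2)).fderiv
    simp only [hx, hD]
    simp [unitVec_apply]
    ring
  have hi : ∀ f : Space → ℝ, Continuous f → Integrable f (cellMeasure lx ly) := fun f hf =>
    memLp_one_iff_integrable.1 (memLp_of_continuous hf 1 lx ly)
  have hgc := hφ.continuous_gradient
  calc ∫ x, ‖φ x‖ ^ 2 ∂(cellMeasure lx ly)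
      ≤ ∫ x, (2 * D x + 4 * ‖∇ φ x‖ ^ 2) ∂(cellMeasure lx ly) := by
        refine integral_mono_ae (hi _ (by have := hφ.continuous; fun_prop)) (hi _ (by fun_prop)) ?_
        filter_upwards [ae_mem_cell lx ly] with x hx
        have hb : |fderiv ℝ φ x (unitVec 2)| ≤ ‖∇ φ x‖ := by
          rw [fderiv_unitVec_eq_inner]
          simpa [norm_unitVec] using abs_real_inner_le_norm (∇ φ x) (unitVec 2)
        have hb2 : (fderiv ℝ φ x (unitVec 2)) ^ 2 ≤ ‖∇ φ x‖ ^ 2 := sq_le_sq' (by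
          linarith [neg_abs_le (fderiv ℝ φ x (unitVec 2))]) ((le_abs_self _).trans hb)
        obtain ⟨-, -, hx0, hx1⟩ := hx
        simp only [hD, Real.norm_eq_abs, sq_abs]
        set p := φ x
        set d := fderiv ℝ φ x (unitVec 2)
        have h3 : (x 2) ^ 2 * d ^ 2 ≤ d ^ 2 := by
          have : (x 2) ^ 2 ≤ 1 := by nlinarith
          nlinarith [sq_nonneg d]
        nlinarith [sq_nonneg (p + 2 * x 2 * d)]
    _ = 4 * ∫ x, ‖∇ φ x‖ ^ 2 ∂(cellMeasure lx ly) := by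
        rw [integral_add ((hi _ hDc).const_mul _) (hi _ (by fun_prop)),
          integral_const_mul, h0, integral_const_mul]
        simp

lemma HasH10Gradient.poincare (hlx : 0 < lx) (hly : 0 < ly) {θ : Space → ℝ} {g : Space → Space}
    (h : HasH10Gradient lx ly θ g) :
    ∫ x, ‖θ x‖ ^ 2 ∂(cellMeasure lx ly) ≤ 4 * ∫ x, ‖g x‖ ^ 2 ∂(cellMeasure lx ly) := by
  obtain ⟨h1, h2, φ, h3, h4, h5⟩ := h
  exact le_of_tendsto_of_tendsto'
    (tendsto_integral_norm_sq (fun n => memLp_of_continuous (h3 n).continuous 2 lx ly) h1 h4)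
    ((tendsto_integral_norm_sq
      (fun n => memLp_of_continuous (h3 n).continuous_gradient 2 lx ly) h2 h5).const_mul 4)
    fun n => (h3 n).poincare hlx hly

/-- The pairs `(φ, ∇φ)` form a subset of the separable metric space `L² × L²`, hence have a
countable dense subset. It allows one null set of times to serve all elements of `H₀¹`. -/
lemma exists_countable_dense_testFunctions (lx ly : ℝ) :
    ∃ d : ℕ → Space → ℝ, (∀ n, IsTestFunction lx ly (d n)) ∧
      ∀ θ g, HasH10Gradient lx ly θ g → ∃ k : ℕ → ℕ,
        Tendsto (fun n => eLpNorm (fun x => d (k n) x - θ x) 2 (cellMeasure lx ly)) atTop (𝓝 0) ∧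
        Tendsto (fun n => eLpNorm (fun x => ∇ (d (k n)) x - g x) 2 (cellMeasure lx ly))
          atTop (𝓝 0) := by
  have m1 : ∀ φ : {φ // IsTestFunction lx ly φ}, MemLp φ.1 2 (cellMeasure lx ly) := fun φ =>
    memLp_of_continuous φ.2.continuous 2 lx ly
  have m2 : ∀ φ : {φ // IsTestFunction lx ly φ}, MemLp (∇ φ.1) 2 (cellMeasure lx ly) := fun φ =>
    memLp_of_continuous φ.2.continuous_gradient 2 lx ly
  let J : {φ // IsTestFunction lx ly φ} → Lp ℝ 2 (cellMeasure lx ly) × Lp Space 2 (cellMeasure lx ly) :=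
    fun φ => ((m1 φ).toLp _, (m2 φ).toLp _)
  have hne : Nonempty (range J) := by
    refine ⟨⟨_, ⟨fun _ => 0, ⟨contDiff_const, fun x => ⟨rfl, rfl⟩⟩, 1, one_pos, fun _ _ => rfl⟩, rfl⟩⟩
  have : Fact ((2 : ℝ≥0∞) ≠ ⊤) := ⟨ENNReal.ofNat_ne_top⟩
  have hsep1 : SecondCountableTopology (Lp ℝ 2 (cellMeasure lx ly)) := inferInstance
  have hsep2 : SecondCountableTopology (Lp Space 2 (cellMeasure lx ly)) := inferInstance
  obtain ⟨s, hs⟩ := TopologicalSpace.exists_dense_seq (range J)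
  choose d hd using fun n => (s n).2
  refine ⟨fun n => (d n).1, fun n => (d n).2, fun θ g hH => ?_⟩
  obtain ⟨h1, h2, φ, h3, h4, h5⟩ := hH
  have hlim : Tendsto (fun n => J ⟨φ n, h3 n⟩) atTop (𝓝 (h1.toLp θ, h2.toLp g)) :=
    (tendsto_toLp (fun n => m1 ⟨φ n, h3 n⟩) h1 h4).prodMk_nhds
      (tendsto_toLp (fun n => m2 ⟨φ n, h3 n⟩) h2 h5)
  have hmem : (h1.toLp θ, h2.toLp g) ∈ closure (range J) :=
    mem_closure_of_tendsto hlim (Eventually.of_forall fun n => mem_range_self _)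
  have hsub : range J ⊆ closure (range fun n => J (d n)) := by
    intro y hy
    have := hs ⟨y, hy⟩
    rw [mem_closure_iff_seq_limit] at this ⊢
    obtain ⟨x, hx, hxl⟩ := this
    refine ⟨fun n => (x n).1, fun n => ?_, (continuous_subtype_val.tendsto _).comp hxl⟩
    obtain ⟨m, hm⟩ := hx n
    exact ⟨m, by simp only [hd, hm]⟩
  have hmem' := closure_minimal hsub isClosed_closure hmem
  rw [mem_closure_iff_seq_limit] at hmem'
  obtain ⟨x, hx, hxl⟩ := hmem'
  choose k hk using hx
  refine ⟨k, ?_, ?_⟩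
  · refine (Lp.tendsto_Lp_iff_tendsto_eLpNorm'' _ (fun n => m1 (d (k n))) _ h1).1 ?_
    have := (continuous_fst.tendsto _).comp hxl
    refine this.congr fun n => ?_
    simp only [Function.comp, ← hk, J]
  · refine (Lp.tendsto_Lp_iff_tendsto_eLpNorm'' _ (fun n => m2 (d (k n))) _ h2).1 ?_
    have := (continuous_snd.tendsto _).comp hxl
    refine this.congr fun n => ?_
    simp only [Function.comp, ← hk, J]

/-! ### The chain rule in `H₀¹`. -/

lemma tendsto_eLpNorm_two_zero_of_dominated {α E : Type*} [MeasurableSpace α] {μ : Measure α}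
    [NormedAddCommGroup E] {f : ℕ → α → E} {B : α → ℝ} (hf : ∀ n, AEStronglyMeasurable (f n) μ)
    (hB : MemLp B 2 μ) (hfB : ∀ n, ∀ᵐ x ∂μ, ‖f n x‖ ≤ B x)
    (hlim : ∀ᵐ x ∂μ, Tendsto (fun n => f n x) atTop (𝓝 0)) :
    Tendsto (fun n => eLpNorm (f n) 2 μ) atTop (𝓝 0) := by
  have h2 : (2 : ℝ≥0∞).toReal = 2 := rfl
  have hint : Tendsto (fun n => ∫⁻ x, ‖f n x‖ₑ ^ (2 : ℝ) ∂μ) atTop (𝓝 0) := by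
    have := tendsto_lintegral_of_dominated_convergence' (μ := μ)
      (F := fun n x => ‖f n x‖ₑ ^ (2 : ℝ)) (f := fun _ => 0) (fun x => ‖B x‖ₑ ^ (2 : ℝ))
      (fun n => (hf n).enorm.pow_const _) (fun n => ?_) ?_ ?_
    · simpa using this
    · filter_upwards [hfB n] with x hx
      gcongr
      rw [enorm_le_iff_norm_le]
      exact hx.trans (le_abs_self _)
    · have := (eLpNorm_lt_top_iff_lintegral_rpow_enorm_lt_top two_ne_zero ENNReal.ofNat_ne_top).1 hB.2
      rw [h2] at this
      exact this.ne
    · filter_upwards [hlim] with x hx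
      have h3 := (ENNReal.continuous_rpow_const (y := 2)).tendsto 0 |>.comp
        (by simpa using hx.enorm)
      simpa [Function.comp_def] using h3
  have : Tendsto (fun n => (∫⁻ x, ‖f n x‖ₑ ^ (2 : ℝ) ∂μ) ^ (1 / 2 : ℝ)) atTop (𝓝 0) := by
    have h3 := (ENNReal.continuous_rpow_const (y := 1 / 2)).tendsto 0 |>.comp hint
    simpa [Function.comp_def] using h3
  refine this.congr fun n => ?_
  rw [eLpNorm_eq_lintegral_rpow_enorm_toReal two_ne_zero ENNReal.ofNat_ne_top, h2]

lemma hasGradientAt_vertical (x : Space) : HasGradientAt (fun x : Space => x 2) (unitVec 2) x := by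
  rw [hasGradientAt_iff_hasFDerivAt]
  refine (EuclideanSpace.proj 2 : Space →L[ℝ] ℝ).hasFDerivAt.congr_fderiv ?_
  ext v
  simp [← inner_unitVec v 2, real_inner_comm]

lemma hasGradientAt_comp_sub {b : ℝ → ℝ} (hb : ContDiff ℝ 1 b) {φ : Space → ℝ}
    (hφ : ContDiff ℝ 1 φ) (x : Space) :
    HasGradientAt (fun x : Space => b (φ x + (1 - x 2)) - b (1 - x 2))
      (deriv b (φ x + (1 - x 2)) • (∇ φ x - unitVec 2) + deriv b (1 - x 2) • unitVec 2) x := by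
  have hz' := (hasGradientAt_iff_hasFDerivAt.1 (hasGradientAt_vertical x)).const_sub 1
  have hd : ∀ y, HasDerivAt b (deriv b y) y := fun y =>
    (hb.differentiable (by simp) y).hasDerivAt
  have h1 := (hd _).comp_hasFDerivAt x
    ((((hφ.differentiable (by simp)) x).hasGradientAt.hasFDerivAt).add hz')
  have h2 := (hd _).comp_hasFDerivAt x hz'
  rw [hasGradientAt_iff_hasFDerivAt]
  refine (h1.sub h2).congr_fderiv ?_
  simp only [map_add, map_sub, map_smul, smul_sub, smul_add, smul_neg, sub_neg_eq_add,
    Pi.add_apply]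
  abel

lemma IsTestFunction.comp_sub {b : ℝ → ℝ} (hb : ContDiff ℝ ∞ b) {φ : Space → ℝ}
    (hφ : IsTestFunction lx ly φ) :
    IsTestFunction lx ly (fun x : Space => b (φ x + (1 - x 2)) - b (1 - x 2)) := by
  obtain ⟨⟨h1, h2⟩, δ, hδ, h3⟩ := hφ
  have hz : ContDiff ℝ ∞ (fun x : Space => 1 - x 2) :=
    contDiff_const.sub (EuclideanSpace.proj 2 : Space →L[ℝ] ℝ).contDiff
  refine ⟨⟨(hb.comp (h1.add hz)).sub (hb.comp hz), fun x => ?_⟩, δ, hδ, fun x hx => ?_⟩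
  · have := h2 x
    simp [this.1, this.2, unitVec_apply]
  · simp [h3 x hx]

lemma aestronglyMeasurable_of_sub {T : Space → ℝ}
    (h : MemLp (fun x => T x - (1 - x 2)) 2 (cellMeasure lx ly)) :
    AEStronglyMeasurable T (cellMeasure lx ly) := by
  have hz : Continuous (fun x : Space => 1 - x 2) := by fun_prop
  refine (h.1.add hz.aestronglyMeasurable).congr (Eventually.of_forall fun x => ?_)
  simp

lemma memLp_of_add_unitVec {G : Space → Space}
    (h : MemLp (fun x => G x + unitVec 2) 2 (cellMeasure lx ly)) :
    MemLp G 2 (cellMeasure lx ly) := by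
  have := h.sub (memLp_of_continuous (f := fun _ => unitVec 2) continuous_const 2 lx ly)
  refine (memLp_congr_ae (Eventually.of_forall fun x => ?_)).1 this
  simp

/-- If `φₙ` approximates `T - (1 - z)`, then `b(φₙ + (1 - z)) - b(1 - z)` is again a test function,
as it vanishes wherever `φₙ` does. These are the approximants. -/
lemma HasH10Gradient.comp_of_bounded_deriv {T : Space → ℝ} {G : Space → Space}
    (h : HasH10Gradient lx ly (fun x => T x - (1 - x 2)) (fun x => G x + unitVec 2))
    {b : ℝ → ℝ} (hb : ContDiff ℝ ∞ b) {C : ℝ} (hC : ∀ r, |deriv b r| ≤ C) :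
    HasH10Gradient lx ly (fun x => b (T x) - b (1 - x 2))
      (fun x => deriv b (T x) • G x + deriv b (1 - x 2) • unitVec 2) := by
  obtain ⟨h1, h2, φ, h3, h4, h5⟩ := h
  have hb1 : ContDiff ℝ 1 b := hb.of_le (by exact_mod_cast le_top)
  have hb' : Continuous (deriv b) := hb1.continuous_deriv le_rfl
  have hz : Continuous (fun x : Space => 1 - x 2) := by fun_prop
  have hC0 : 0 ≤ C := (abs_nonneg _).trans (hC 0)
  have hTm := aestronglyMeasurable_of_sub h1
  have hG := memLp_of_add_unitVec h2
  have hlip : ∀ r s, |b r - b s| ≤ C * |r - s| := fun r s =>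
    Convex.norm_image_sub_le_of_norm_deriv_le (s := univ)
      (fun x _ => hb1.differentiable (by simp) x) (fun x _ => hC x) convex_univ trivial trivial
  -- A subsequence converging almost everywhere is needed for the coefficient `b'(φₙ + (1 - z))`,
  -- which is controlled only by dominated convergence.
  obtain ⟨ns, hns, hae⟩ := (tendstoInMeasure_of_tendsto_eLpNorm_of_ne_top
    (f := φ) (g := fun x => T x - (1 - x 2)) two_ne_zero
    ENNReal.ofNat_ne_top (fun n => (h3 n).continuous.aestronglyMeasurable) h1.1 h4).exists_seq_tendsto_ae
  have hθ : MemLp (fun x => b (T x) - b (1 - x 2)) 2 (cellMeasure lx ly) := by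
    refine MemLp.of_le_mul (c := C) h1
      ((hb1.continuous.comp_aestronglyMeasurable hTm).sub
        (hb1.continuous.comp hz).aestronglyMeasurable) (Eventually.of_forall fun x => ?_)
    simpa using hlip (T x) (1 - x 2)
  have hg : MemLp (fun x => deriv b (T x) • G x + deriv b (1 - x 2) • unitVec 2) 2
      (cellMeasure lx ly) := by
    refine MemLp.add (MemLp.of_le_mul (c := C) hG
      ((hb'.comp_aestronglyMeasurable hTm).smul hG.1) (Eventually.of_forall fun x => ?_))
      (memLp_of_continuous (by fun_prop) 2 lx ly)
    rw [norm_smul]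
    gcongr
    exact hC _
  refine ⟨hθ, hg, fun n x => b (φ (ns n) x + (1 - x 2)) - b (1 - x 2),
    fun n => (h3 _).comp_sub hb, ?_, ?_⟩
  · have hlim : Tendsto (fun n => ENNReal.ofReal C *
        eLpNorm (fun x => φ (ns n) x - (T x - (1 - x 2))) 2 (cellMeasure lx ly)) atTop (𝓝 0) := by
      simpa using ENNReal.Tendsto.const_mul (h4.comp hns.tendsto_atTop) (Or.inr ENNReal.ofReal_ne_top)
    refine tendsto_of_tendsto_of_tendsto_of_le_of_le tendsto_const_nhds hlim (fun _ => zero_le)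
      fun n => eLpNorm_le_mul_eLpNorm_of_ae_le_mul (Eventually.of_forall fun x => ?_) 2
    have := hlip (φ (ns n) x + (1 - x 2)) (T x)
    simp only [Real.norm_eq_abs]
    convert this using 2 <;> ring_nf
  -- The first summand is small because the gradients converge and `b'` is bounded; the second
  -- because its coefficient tends to zero and it is dominated by `2C|G|`.
  · have hgrad : ∀ n x, ∇ (fun x : Space => b (φ (ns n) x + (1 - x 2)) - b (1 - x 2)) x -
        (deriv b (T x) • G x + deriv b (1 - x 2) • unitVec 2) =
        deriv b (φ (ns n) x + (1 - x 2)) • (∇ (φ (ns n)) x - (G x + unitVec 2)) +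
          (deriv b (φ (ns n) x + (1 - x 2)) - deriv b (T x)) • G x := by
      intro n x
      rw [(hasGradientAt_comp_sub hb1 ((h3 (ns n)).contDiff 1) x).gradient]
      module
    simp only [hgrad]
    have m1 : ∀ n, AEStronglyMeasurable (fun x =>
        deriv b (φ (ns n) x + (1 - x 2)) • (∇ (φ (ns n)) x - (G x + unitVec 2)))
        (cellMeasure lx ly) := fun n =>
      (hb'.comp ((h3 _).continuous.add hz)).aestronglyMeasurable.smul
        ((h3 _).continuous_gradient.aestronglyMeasurable.sub h2.1)
    have m2 : ∀ n, AEStronglyMeasurable (fun x =>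
        (deriv b (φ (ns n) x + (1 - x 2)) - deriv b (T x)) • G x) (cellMeasure lx ly) := fun n =>
      ((hb'.comp ((h3 _).continuous.add hz)).aestronglyMeasurable.sub
        (hb'.comp_aestronglyMeasurable hTm)).smul hG.1
    have l1 : Tendsto (fun n => eLpNorm (fun x =>
        deriv b (φ (ns n) x + (1 - x 2)) • (∇ (φ (ns n)) x - (G x + unitVec 2))) 2
        (cellMeasure lx ly)) atTop (𝓝 0) := by
      have hlim : Tendsto (fun n => ENNReal.ofReal C *
          eLpNorm (fun x => ∇ (φ (ns n)) x - (G x + unitVec 2)) 2 (cellMeasure lx ly))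
          atTop (𝓝 0) := by
        simpa using ENNReal.Tendsto.const_mul (h5.comp hns.tendsto_atTop)
          (Or.inr ENNReal.ofReal_ne_top)
      refine tendsto_of_tendsto_of_tendsto_of_le_of_le tendsto_const_nhds hlim (fun _ => zero_le)
        fun n => eLpNorm_le_mul_eLpNorm_of_ae_le_mul (Eventually.of_forall fun x => ?_) 2
      rw [norm_smul]
      gcongr
      exact hC _
    have l2 : Tendsto (fun n => eLpNorm (fun x =>
        (deriv b (φ (ns n) x + (1 - x 2)) - deriv b (T x)) • G x) 2
        (cellMeasure lx ly)) atTop (𝓝 0) := by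
      refine tendsto_eLpNorm_two_zero_of_dominated m2 (B := fun x => (2 * C) * ‖G x‖)
        (hG.norm.const_mul _) (fun n => Eventually.of_forall fun x => ?_) ?_
      · rw [norm_smul]
        gcongr
        calc _ ≤ |deriv b (φ (ns n) x + (1 - x 2))| + |deriv b (T x)| := abs_sub _ _
          _ ≤ 2 * C := by linarith [hC (φ (ns n) x + (1 - x 2)), hC (T x)]
      · filter_upwards [hae] with x hx
        have h6 : Tendsto (fun n => φ (ns n) x + (1 - x 2)) atTop (𝓝 (T x)) := by
          simpa using hx.add_const (1 - x 2)
        have h7 := ((hb'.tendsto (T x)).comp h6).sub_const (deriv b (T x))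
        simpa using h7.smul_const (G x)
    have l3 := l1.add l2
    rw [add_zero] at l3
    exact tendsto_of_tendsto_of_tendsto_of_le_of_le tendsto_const_nhds l3 (fun _ => zero_le)
      fun n => eLpNorm_add_le (m1 n) (m2 n) (by norm_num)

lemma exists_bounded_deriv_eqOn {b : ℝ → ℝ} (hb : ContDiff ℝ ∞ b) (M : ℝ) :
    ∃ c : ℝ → ℝ, ContDiff ℝ ∞ c ∧ (∃ C, ∀ r, |deriv c r| ≤ C) ∧
      ∀ r, |r| ≤ M → c r = b r ∧ deriv c r = deriv b r := by
  let χ : ContDiffBump (0 : ℝ) := ⟨|M| + 1, |M| + 2, by positivity, by linarith⟩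
  have hc : ContDiff ℝ ∞ (fun r => χ r * b r) := χ.contDiff.mul hb
  have hsupp : HasCompactSupport (fun r => χ r * b r) := χ.hasCompactSupport.mul_right
  refine ⟨fun r => χ r * b r, hc, ?_, fun r hr => ?_⟩
  · exact (hc.continuous_deriv (by exact_mod_cast le_top)).bounded_above_of_compact_support hsupp.deriv
  · have hr' : r ∈ Metric.ball (0 : ℝ) (|M| + 1) := by
      simp only [Metric.mem_ball, dist_zero_right, Real.norm_eq_abs]
      linarith [le_abs_self M]
    have he : (fun r => χ r * b r) =ᶠ[𝓝 r] b := by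
      filter_upwards [Metric.isOpen_ball.mem_nhds hr'] with s hs
      rw [χ.one_of_mem_closedBall (Metric.ball_subset_closedBall hs), one_mul]
    exact ⟨he.eq_of_nhds, he.deriv_eq⟩

lemma HasH10Gradient.comp {T : Space → ℝ} {G : Space → Space}
    (h : HasH10Gradient lx ly (fun x => T x - (1 - x 2)) (fun x => G x + unitVec 2))
    {M : ℝ} (hT : ∀ x, |T x| ≤ M) {b : ℝ → ℝ} (hb : ContDiff ℝ ∞ b) :
    HasH10Gradient lx ly (fun x => b (T x) - b (1 - x 2))
      (fun x => deriv b (T x) • G x + deriv b (1 - x 2) • unitVec 2) := by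
  -- Only values of `b` on the ranges of `T` and of `1 - z ∈ (0, 1)` matter, whence the radius `max
  -- M 1`.
  obtain ⟨c, hc, ⟨C, hC⟩, hcb⟩ := exists_bounded_deriv_eqOn hb (max M 1)
  have h1 : ∀ x, |T x| ≤ max M 1 := fun x => (hT x).trans (le_max_left _ _)
  have h2 : ∀ᵐ x ∂(cellMeasure lx ly), |1 - x 2| ≤ max M 1 := by
    filter_upwards [ae_mem_cell lx ly] with x hx
    obtain ⟨-, -, hx0, hx1⟩ := hx
    exact (abs_le.2 ⟨by linarith, by linarith⟩).trans (le_max_right _ _)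
  refine (h.comp_of_bounded_deriv hc hC).congr ?_ ?_
  · filter_upwards [h2] with x hx
    rw [(hcb _ (h1 x)).1, (hcb _ hx).1]
  · filter_upwards [h2] with x hx
    rw [(hcb _ (h1 x)).2, (hcb _ hx).2]

/-! ### From the distributional time derivative to increments. -/

lemma measurePreserving_shear {Y : Type*} [AddGroup Y] [MeasurableSpace Y] [MeasurableAdd₂ Y]
    (μ : Measure Y) [SFinite μ] [μ.IsAddRightInvariant] (ρ : Measure ℝ) [SFinite ρ] {c : ℝ → Y}
    (hc : Measurable c) :
    MeasurePreserving (fun q : ℝ × Y => (q.1, q.2 + c q.1)) (ρ.prod μ) (ρ.prod μ) :=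
  (MeasurePreserving.id ρ).skew_product (g := fun r y => y + c r)
    (measurable_snd.add (hc.comp measurable_fst))
    (Eventually.of_forall fun r => map_add_right_eq_self μ (c r))

lemma contDiff_infty_of_deriv {f g : ℝ → ℝ} (hf : ∀ x, HasDerivAt f (g x) x)
    (hg : ContDiff ℝ ∞ g) : ContDiff ℝ ∞ f := by
  rw [contDiff_infty_iff_deriv]
  refine ⟨fun x => (hf x).differentiableAt, ?_⟩
  have : deriv f = g := funext fun x => (hf x).deriv
  rwa [this]

lemma hasDerivAt_primitive {g : ℝ → ℝ} (hg : Continuous g) (x : ℝ) :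
    HasDerivAt (fun y => ∫ s in (0 : ℝ)..y, g s) (g x) x :=
  intervalIntegral.integral_hasDerivAt_right (hg.intervalIntegrable _ _)
    (hg.stronglyMeasurableAtFilter _ _) hg.continuousAt

lemma contDiff_primitive {g : ℝ → ℝ} (hg : ContDiff ℝ ∞ g) :
    ContDiff ℝ ∞ (fun y => ∫ s in (0 : ℝ)..y, g s) :=
  contDiff_infty_of_deriv (hasDerivAt_primitive hg.continuous) hg

/-- A bounded function with locally integrable distributional derivative on the half-line has
the increments prescribed by that derivative. -/
lemma ae_increment_eq_integral {m f : ℝ → ℝ} {C : ℝ} (hm : Measurable m) (hmC : ∀ t, |m t| ≤ C)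
    (hf : ∀ τ : ℝ, IntegrableOn f (Ioc 0 τ))
    (hweak : ∀ η : ℝ → ℝ, ContDiff ℝ ∞ η → HasCompactSupport η → tsupport η ⊆ Ioi 0 →
      ∫ t in Ioi (0 : ℝ), (deriv η t * m t + η t * f t) = 0) {h : ℝ} (hh : 0 < h) :
    ∀ᵐ s, h < s → m s - m (s - h) = ∫ r in Ioc 0 h, f (s - r) := by
  have key : ∀ R : ℝ, ∀ᵐ s, s ∈ Ioo h R → m s - m (s - h) - ∫ r in Ioc 0 h, f (s - r) = 0 := by
    intro R
    -- Truncating to `(0, R]` makes `f` globally integrable. It loses nothing: `s - r` stays in `(0,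
    -- R]` for `s` in `(h, R)` and `r` in `(0, h]`.
    set F : ℝ → ℝ := (Ioc 0 R).indicator f with hF
    have hFi : Integrable F := (integrable_indicator_iff measurableSet_Ioc).2 (hf R)
    set ρ : Measure ℝ := volume.restrict (Ioc 0 h) with hρ
    have hshear := measurePreserving_shear (volume : Measure ℝ) ρ (c := fun r => -r) measurable_neg
    have hFs : Integrable (fun q : ℝ × ℝ => F (q.2 - q.1)) (ρ.prod volume) := by
      have := (hshear.integrable_comp (hFi.comp_snd ρ).aestronglyMeasurable).2 (hFi.comp_snd ρ)
      simpa [Function.comp_def, sub_eq_add_neg] using this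
    have hFr : Integrable (fun s => ∫ r, F (s - r) ∂ρ) := hFs.integral_prod_right
    have hloc : LocallyIntegrable m := by
      have : LocallyIntegrable fun _ : ℝ => C := locallyIntegrable_const C
      exact this.mono hm.aestronglyMeasurable
        (Eventually.of_forall fun t => (hmC t).trans (le_abs_self C))
    have hloc' : LocallyIntegrable fun s => m (s - h) := by
      have : LocallyIntegrable fun _ : ℝ => C := locallyIntegrable_const C
      exact this.mono (hm.comp (measurable_id.sub_const h)).aestronglyMeasurable
        (Eventually.of_forall fun t => (hmC _).trans (le_abs_self C))
    have hD : LocallyIntegrable fun s => m s - m (s - h) - ∫ r, F (s - r) ∂ρ :=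
      (hloc.sub hloc').sub hFr.locallyIntegrable
    have hz := isOpen_Ioo.ae_eq_zero_of_integral_contDiff_smul_eq_zero (U := Ioo h R)
      (hD.locallyIntegrableOn _) (fun ζ hζ hζc hζs => ?_)
    · filter_upwards [hz] with s hs hsU
      rw [← hs hsU]
      congr 1
      refine setIntegral_congr_fun measurableSet_Ioc fun r hr => ?_
      rw [hF, indicator_of_mem]
      exact ⟨by linarith [hr.2, hsU.1], by linarith [hr.1, hsU.2]⟩
    · have hζi : Integrable ζ := hζ.continuous.integrable_of_hasCompactSupport hζc
      obtain ⟨B, hB⟩ := hζ.continuous.bounded_above_of_compact_support hζc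
      set Z : ℝ → ℝ := fun y => ∫ s in (0 : ℝ)..y, ζ s with hZ
      -- This is the moving integral of `ζ` over `[t, t + h]`. Its derivative is a difference of
      -- translates of `ζ`, and by Fubini pairing it with `f` is pairing `ζ` with the moving
      -- integral of `f`. As `ζ` lives in `(h, R)`, the function `η` lives in `(0, R)`.
      set η : ℝ → ℝ := fun t => Z (t + h) - Z t with hη
      have hηd : ∀ t, HasDerivAt η (ζ (t + h) - ζ t) t := fun t =>
        ((hasDerivAt_primitive hζ.continuous (t + h)).comp_add_const t h).sub
          (hasDerivAt_primitive hζ.continuous t)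
      have hηs : ContDiff ℝ ∞ η :=
        ((contDiff_primitive hζ).comp (contDiff_id.add contDiff_const)).sub (contDiff_primitive hζ)
      have hηint : ∀ t, η t = ∫ r, ζ (t + r) ∂ρ := by
        intro t
        simp only [hη, hZ]
        rw [intervalIntegral.integral_interval_sub_left (hζ.continuous.intervalIntegrable _ _)
          (hζ.continuous.intervalIntegrable _ _), hρ,
          ← intervalIntegral.integral_of_le hh.le,
          intervalIntegral.integral_comp_add_left (fun s => ζ s)]
        simp
      have hηsupp : tsupport η ⊆ Ioo 0 R ∧ HasCompactSupport η := by
        by_cases hne : (tsupport ζ).Nonempty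
        · obtain ⟨a, ha, hamin⟩ := hζc.exists_isLeast hne
          obtain ⟨b, hb, hbmax⟩ := hζc.exists_isGreatest hne
          have hsub : Function.support η ⊆ Icc (a - h) b := by
            intro t ht
            by_contra hnot
            apply ht
            rw [hηint]
            refine integral_eq_zero_of_ae ?_
            filter_upwards [ae_restrict_mem measurableSet_Ioc] with r hr
            by_contra hne'
            have hmem : t + r ∈ tsupport ζ := subset_tsupport _ hne'
            exact hnot ⟨by linarith [hamin hmem, hr.2], by linarith [hbmax hmem, hr.1]⟩
          have hsub' : tsupport η ⊆ Icc (a - h) b := closure_minimal hsub isClosed_Icc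
          refine ⟨hsub'.trans fun t ht => ⟨?_, ?_⟩, ?_⟩
          · linarith [(hζs ha).1, ht.1]
          · linarith [(hζs hb).2, ht.2]
          · exact isCompact_Icc.of_isClosed_subset (isClosed_tsupport _) hsub'
        · have hζz : ζ = 0 := by
            rw [← tsupport_eq_empty_iff]
            exact not_nonempty_iff_eq_empty.1 hne
          have hηz : η = 0 := by
            funext t
            rw [hηint, hζz]
            simp
          rw [hηz]
          exact ⟨by simp [tsupport_eq_empty_iff.2 rfl], HasCompactSupport.zero⟩
      have hw := hweak η hηs hηsupp.2 (hηsupp.1.trans Ioo_subset_Ioi_self)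
      have hη0 : ∀ t, t ∉ Ioo 0 R → η t = 0 := fun t ht => by
        by_contra hne
        exact ht (hηsupp.1 (subset_tsupport _ hne))
      have hηd0 : ∀ t, t ∉ Ioi (0 : ℝ) → deriv η t = 0 := fun t ht => by
        by_contra hne
        exact ht (hηsupp.1 (support_deriv_subset hne)).1
      have hw' : ∫ t, ((ζ (t + h) - ζ t) * m t + η t * F t) = 0 := by
        rw [← hw, ← integral_indicator measurableSet_Ioi]
        refine integral_congr_ae (Eventually.of_forall fun t => ?_)
        by_cases ht : t ∈ Ioi (0 : ℝ)
        · simp only [indicator_of_mem ht, (hηd t).deriv]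
          by_cases hR : t ∈ Ioc 0 R
          · rw [hF, indicator_of_mem hR]
          · rw [hη0 t fun h' => hR ⟨h'.1, h'.2.le⟩]
            simp
        · have := hηd0 t ht
          rw [(hηd t).deriv] at this
          simp only [indicator_of_notMem ht, this, hη0 t fun h' => ht h'.1]
          simp
      have hmζ : ∀ g : ℝ → ℝ, Integrable g → Integrable fun t => g t * m t := fun g hg =>
        hg.mul_bdd hm.aestronglyMeasurable (Eventually.of_forall hmC)
      have hmζ' : Integrable fun s => ζ s * m (s - h) :=
        hζi.mul_bdd (hm.comp (measurable_id.sub_const h)).aestronglyMeasurable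
          (Eventually.of_forall fun _ => hmC _)
      have hI1 : Integrable (fun q : ℝ × ℝ => F q.2 * ζ (q.2 + q.1)) (ρ.prod volume) :=
        (hFi.comp_snd ρ).mul_bdd (hζ.continuous.comp (by fun_prop)).aestronglyMeasurable
          (Eventually.of_forall fun _ => hB _)
      have hI2 : Integrable (fun q : ℝ × ℝ => F (q.2 - q.1) * ζ q.2) (ρ.prod volume) :=
        hFs.mul_bdd (hζ.continuous.comp (by fun_prop)).aestronglyMeasurable
          (Eventually.of_forall fun _ => hB _)
      have hfub : ∫ t, η t * F t = ∫ s, ζ s * ∫ r, F (s - r) ∂ρ := by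
        calc ∫ t, η t * F t = ∫ t, ∫ r, F t * ζ (t + r) ∂ρ := by
              refine integral_congr_ae (Eventually.of_forall fun t => ?_)
              simp only [hηint, integral_const_mul]
              ring
          _ = ∫ r, ∫ t, F t * ζ (t + r) ∂volume ∂ρ := (integral_integral_swap hI1).symm
          _ = ∫ r, ∫ s, F (s - r) * ζ s ∂volume ∂ρ := by
              refine integral_congr_ae (Eventually.of_forall fun r => ?_)
              simp only
              rw [← integral_sub_right_eq_self (fun t => F t * ζ (t + r)) r]
              simp
          _ = ∫ s, ∫ r, F (s - r) * ζ s ∂ρ := integral_integral_swap hI2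
          _ = ∫ s, ζ s * ∫ r, F (s - r) ∂ρ := by
              refine integral_congr_ae (Eventually.of_forall fun s => ?_)
              simp only [integral_mul_const]
              ring
      have hηF : Integrable fun t => η t * F t := by
        obtain ⟨B', hB'⟩ := hηs.continuous.bounded_above_of_compact_support hηsupp.2
        exact hFi.bdd_mul hηs.continuous.aestronglyMeasurable (Eventually.of_forall hB')
      have hζr : Integrable fun s => ζ s * ∫ r, F (s - r) ∂ρ :=
        hFr.bdd_mul hζ.continuous.aestronglyMeasurable (Eventually.of_forall hB)
      have hζh : Integrable fun t => ζ (t + h) := hζi.comp_add_right h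
      have e1 : ∫ t, ζ (t + h) * m t = ∫ s, ζ s * m (s - h) := by
        rw [← integral_sub_right_eq_self (fun t => ζ (t + h) * m t) h]
        simp
      have e2 : ∫ t, ((ζ (t + h) - ζ t) * m t + η t * F t) =
          (∫ t, ζ (t + h) * m t) - (∫ t, ζ t * m t) + ∫ t, η t * F t := by
        have hd : Integrable fun t => ζ (t + h) * m t - ζ t * m t := (hmζ _ hζh).sub (hmζ _ hζi)
        rw [← integral_sub (hmζ _ hζh) (hmζ _ hζi), ← integral_add hd hηF]
        refine integral_congr_ae (Eventually.of_forall fun t => ?_)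
        ring
      have e3 : ∫ s, ζ s • (m s - m (s - h) - ∫ r, F (s - r) ∂ρ) =
          (∫ t, ζ t * m t) - (∫ s, ζ s * m (s - h)) - ∫ s, ζ s * ∫ r, F (s - r) ∂ρ := by
        have hd : Integrable fun t => ζ t * m t - ζ t * m (t - h) := (hmζ _ hζi).sub hmζ'
        rw [← integral_sub (hmζ _ hζi) hmζ', ← integral_sub hd hζr]
        refine integral_congr_ae (Eventually.of_forall fun t => ?_)
        simp only [smul_eq_mul]
        ring
      rw [e3]
      rw [e2, e1, hfub] at hw'
      linarith
  have hall : ∀ᵐ s, ∀ n : ℕ, s ∈ Ioo h n → m s - m (s - h) - ∫ r in Ioc 0 h, f (s - r) = 0 :=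
    ae_all_iff.2 fun n => key n
  filter_upwards [hall] with s hs hhs
  obtain ⟨n, hn⟩ := exists_nat_gt s
  exact sub_eq_zero.1 (hs n ⟨hhs, hn⟩)

/-! ### Regular solutions on space-time slabs. -/

/-- Lebesgue measure on the space-time slab `(a, b] × Ω`. -/
noncomputable def slab (lx ly a b : ℝ) : Measure (ℝ × Space) :=
  (volume.restrict (Ioc a b)).prod (cellMeasure lx ly)

instance isFiniteMeasure_slab (lx ly a b : ℝ) : IsFiniteMeasure (slab lx ly a b) := by
  unfold slab
  infer_instance

lemma slab_eq_restrict (lx ly a b : ℝ) :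
    slab lx ly a b = volume.restrict (Ioc a b ×ˢ cell lx ly) := by
  rw [slab, cellMeasure, Measure.prod_restrict, Measure.volume_eq_prod]

lemma slab_mono {a b a' b' : ℝ} (h : Ioc a b ⊆ Ioc a' b') : slab lx ly a b ≤ slab lx ly a' b' := by
  rw [slab_eq_restrict, slab_eq_restrict]
  exact Measure.restrict_mono (prod_mono h subset_rfl) le_rfl

/-- The flux-form weak solutions with everywhere defined, jointly measurable data, to which the
general case reduces by changing all the fields on null sets. -/
structure IsRegularSolution (lx ly M : ℝ) (u : ℝ → Space → Space) (T : ℝ → Space → ℝ)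
    (G : ℝ → Space → Space) : Prop where
  meas_u : Measurable fun p : ℝ × Space => u p.1 p.2
  meas_T : Measurable fun p : ℝ × Space => T p.1 p.2
  meas_G : Measurable fun p : ℝ × Space => G p.1 p.2
  bdd : ∀ t x, |T t x| ≤ M
  memLp_u : ∀ τ, MemLp (fun p : ℝ × Space => u p.1 p.2) 2 (slab lx ly 0 τ)
  memLp_G : ∀ τ, MemLp (fun p : ℝ × Space => G p.1 p.2) 2 (slab lx ly 0 τ)
  wall : NoPenetration lx ly u
  dirichlet : ∀ᵐ t ∂(volume.restrict (Ioi (0 : ℝ))),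
    HasH10Gradient lx ly (fun x => T t x - (1 - x 2)) (fun x => G t x + unitVec 2)
  weak : ∀ φ, IsTestFunction lx ly φ → ∀ η : ℝ → ℝ, ContDiff ℝ ∞ η → HasCompactSupport η →
    tsupport η ⊆ Ioi 0 →
    ∫ t in Ioi (0 : ℝ), (deriv η t * (∫ x, T t x * φ x ∂(cellMeasure lx ly)) +
      η t * ∫ x, inner ℝ (T t x • u t x - G t x) (∇ φ x) ∂(cellMeasure lx ly)) = 0

lemma ae_memLp_slice {E : Type*} [NormedAddCommGroup E] [MeasurableSpace E] [BorelSpace E]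
    [SecondCountableTopology E] {f : ℝ × Space → E} (hf : Measurable f)
    (h : ∀ τ, MemLp f 2 (slab lx ly 0 τ)) :
    ∀ᵐ t ∂(volume.restrict (Ioi (0 : ℝ))), MemLp (fun x => f (t, x)) 2 (cellMeasure lx ly) := by
  have h1 : ∀ n : ℕ, ∀ᵐ t, t ∈ Ioc (0 : ℝ) n → MemLp (fun x => f (t, x)) 2 (cellMeasure lx ly) := by
    intro n
    have h2 := (h n).integrable_norm_pow two_ne_zero
    have h3 := (ae_restrict_iff' measurableSet_Ioc).1 h2.prod_right_ae
    filter_upwards [h3] with t ht htn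
    have hm : AEStronglyMeasurable (fun x => f (t, x)) (cellMeasure lx ly) :=
      (hf.comp measurable_prodMk_left).aestronglyMeasurable
    refine (integrable_norm_rpow_iff hm two_ne_zero ENNReal.ofNat_ne_top).1 ?_
    simpa using ht htn
  rw [ae_restrict_iff' measurableSet_Ioi]
  filter_upwards [ae_all_iff.2 h1] with t ht h0
  obtain ⟨n, hn⟩ := exists_nat_gt t
  exact ht n ⟨h0, hn.le⟩

namespace IsRegularSolution

variable {M : ℝ} {u : ℝ → Space → Space} {T : ℝ → Space → ℝ} {G : ℝ → Space → Space}

/-- Boundedness of `T` is what puts `T u` in `L²`; the time derivative of `T` can then be paired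
with any element of `H₀¹`. -/
lemma memLp_flux (S : IsRegularSolution lx ly M u T G) (τ : ℝ) :
    MemLp (fun p : ℝ × Space => T p.1 p.2 • u p.1 p.2 - G p.1 p.2) 2 (slab lx ly 0 τ) := by
  refine MemLp.sub (MemLp.of_le_mul (c := M) (S.memLp_u τ)
    (S.meas_T.smul S.meas_u).aestronglyMeasurable (Eventually.of_forall fun p => ?_)) (S.memLp_G τ)
  rw [norm_smul]
  gcongr
  exact S.bdd _ _

lemma memLp_flux_reflect (S : IsRegularSolution lx ly M u T G) {h s : ℝ} (hs : h < s) :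
    MemLp (fun q : ℝ × Space => T (s - q.1) q.2 • u (s - q.1) q.2 - G (s - q.1) q.2) 2
      ((volume.restrict (Ioc 0 h)).prod (cellMeasure lx ly)) := by
  have hmp : MeasurePreserving (fun r : ℝ => s - r) (volume.restrict (Ioc 0 h))
      (volume.restrict (Ico (s - h) s)) := by
    have := (Measure.measurePreserving_sub_left (volume : Measure ℝ) s).restrict_preimage
      (s := Ico (s - h) s) measurableSet_Ico
    have he : (fun r : ℝ => s - r) ⁻¹' Ico (s - h) s = Ioc 0 h := by
      ext r
      simp only [mem_preimage, mem_Ico, mem_Ioc]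
      constructor <;> rintro ⟨h1, h2⟩ <;> constructor <;> linarith
    rwa [he] at this
  have hprod := hmp.prod (MeasurePreserving.id (cellMeasure lx ly))
  have hle : (volume.restrict (Ico (s - h) s)).prod (cellMeasure lx ly) ≤ slab lx ly 0 s := by
    rw [slab_eq_restrict, cellMeasure, Measure.prod_restrict, ← Measure.volume_eq_prod]
    have hsub : Ico (s - h) s ⊆ Ioc 0 s := fun r hr => ⟨by linarith [hr.1], hr.2.le⟩
    exact Measure.restrict_mono (prod_mono hsub subset_rfl) le_rfl
  exact ((S.memLp_flux s).mono_measure hle).comp_measurePreserving hprod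

/-- The exceptional set of `s` does not depend on `θ`; this matters because the equation will be
tested with a `θ` built from `T s` itself. The identity is obtained for a countable dense family of
test functions, then extended by `L²` convergence of functions and gradients. -/
lemma ae_increment_pairing (S : IsRegularSolution lx ly M u T G) {h : ℝ} (hh : 0 < h) :
    ∀ᵐ s, h < s → ∀ θ g, HasH10Gradient lx ly θ g →
      ∫ x, (T s x - T (s - h) x) * θ x ∂(cellMeasure lx ly) =
        ∫ r in Ioc 0 h, ∫ x, inner ℝ (T (s - r) x • u (s - r) x - G (s - r) x) (g x)
          ∂(cellMeasure lx ly) := by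
  obtain ⟨d, hd, hdense⟩ := exists_countable_dense_testFunctions lx ly
  set μ := cellMeasure lx ly with hμ
  set ρ : Measure ℝ := volume.restrict (Ioc 0 h) with hρ
  have hslice : ∀ t, MemLp (T t) 2 μ := fun t =>
    MemLp.of_bound (S.meas_T.comp measurable_prodMk_left).aestronglyMeasurable M
      (Eventually.of_forall (S.bdd t))
  have hdc : ∀ n, MemLp (d n) 2 μ := fun n => memLp_of_continuous (hd n).continuous 2 lx ly
  have hdg : ∀ n, MemLp (∇ (d n)) 2 μ := fun n =>
    memLp_of_continuous (hd n).continuous_gradient 2 lx ly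
  have hTd : ∀ t, ∀ θ : Space → ℝ, MemLp θ 2 μ → Integrable (fun x => T t x * θ x) μ :=
    fun t θ hθ => (hθ.integrable one_le_two).bdd_mul (hslice t).1
      (Eventually.of_forall (S.bdd t))
  have hn : ∀ n, ∀ᵐ s, h < s → ∫ x, T s x * d n x ∂μ - ∫ x, T (s - h) x * d n x ∂μ =
      ∫ r in Ioc 0 h, ∫ x, inner ℝ (T (s - r) x • u (s - r) x - G (s - r) x) (∇ (d n) x) ∂μ := by
    intro n
    refine ae_increment_eq_integral (m := fun t => ∫ x, T t x * d n x ∂μ)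
      (f := fun t => ∫ x, inner ℝ (T t x • u t x - G t x) (∇ (d n) x) ∂μ)
      (C := ∫ x, M * |d n x| ∂μ) ?_ ?_ ?_ (S.weak _ (hd n)) hh
    · have : StronglyMeasurable (fun p : ℝ × Space => T p.1 p.2 * d n p.2) :=
        (S.meas_T.mul ((hd n).continuous.measurable.comp measurable_snd)).stronglyMeasurable
      exact this.integral_prod_right.measurable
    · intro t
      change ‖∫ x, T t x * d n x ∂μ‖ ≤ _
      refine (norm_integral_le_integral_norm _).trans ?_
      refine integral_mono_of_nonneg (Eventually.of_forall fun x => norm_nonneg _)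
        (((hdc n).integrable one_le_two).abs.const_mul M) (Eventually.of_forall fun x => ?_)
      simp only [norm_mul, Real.norm_eq_abs]
      gcongr
      exact S.bdd t x
    · intro τ
      have hg2 : MemLp (fun p : ℝ × Space => ∇ (d n) p.2) 2
          (slab lx ly 0 τ) := (hdg n).comp_snd (volume.restrict (Ioc 0 τ))
      exact (integrable_inner_of_memLp (S.memLp_flux τ) hg2).integral_prod_left
  filter_upwards [ae_all_iff.2 hn] with s hs hhs θ g hθg
  obtain ⟨k, hk1, hk2⟩ := hdense θ g hθg
  have hF := S.memLp_flux_reflect hhs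
  have hgs : MemLp (fun q : ℝ × Space => g q.2) 2 (ρ.prod μ) := hθg.2.1.comp_snd _
  have hds : ∀ n, MemLp (fun q : ℝ × Space => ∇ (d (k n)) q.2) 2 (ρ.prod μ) := fun n =>
    (hdg (k n)).comp_snd _
  have hl : Tendsto (fun n => eLpNorm (fun q : ℝ × Space => ∇ (d (k n)) q.2 - g q.2) 2
      (ρ.prod μ)) atTop (𝓝 0) := by
    -- On the product the norm only acquires the factor `h^(1/2)`, since the functions do not depend
    -- on `r`.
    have he : ∀ n, eLpNorm (fun q : ℝ × Space => ∇ (d (k n)) q.2 - g q.2) 2 (ρ.prod μ) =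
        (ρ univ) ^ (1 / (2 : ℝ≥0∞)).toReal * eLpNorm (fun x => ∇ (d (k n)) x - g x) 2 μ := by
      intro n
      have hm : AEStronglyMeasurable (fun x => ∇ (d (k n)) x - g x) μ :=
        ((hdg (k n)).sub hθg.2.1).1
      rw [← smul_eq_mul, ← eLpNorm_smul_measure_of_ne_top (p := 2) ENNReal.ofNat_ne_top,
        ← Measure.map_snd_prod, eLpNorm_map_measure _ measurable_snd.aemeasurable]
      · rfl
      · rw [Measure.map_snd_prod]
        exact hm.smul_measure _
    simp only [he]
    have := ENNReal.Tendsto.const_mul (a := (ρ univ) ^ (1 / (2 : ℝ≥0∞)).toReal) hk2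
      (Or.inr (ENNReal.rpow_ne_top_of_nonneg (by positivity) (measure_ne_top _ _)))
    simpa using this
  have hR := tendsto_integral_inner hF hds hgs hl
  have hL := tendsto_integral_mul (q := fun x => T s x - T (s - h) x)
    ((hslice s).sub (hslice (s - h))) (fun n => hdc (k n)) hθg.1 hk1
  have heq : ∀ n, ∫ x, (T s x - T (s - h) x) * d (k n) x ∂μ =
      ∫ q, inner ℝ (T (s - q.1) q.2 • u (s - q.1) q.2 - G (s - q.1) q.2) (∇ (d (k n)) q.2)
        ∂(ρ.prod μ) := by
    intro n
    rw [integral_prod _ (integrable_inner_of_memLp hF (hds n)), ← hs (k n) hhs,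
      ← integral_sub (hTd _ _ (hdc _)) (hTd _ _ (hdc _))]
    simp only [sub_mul]
  rw [← integral_prod _ (integrable_inner_of_memLp hF hgs)]
  simp only [heq] at hL
  exact tendsto_nhds_unique hL hR

end IsRegularSolution

/-! ### Testing with convex nonlinearities. -/

instance isAddLeftInvariant_volume_spaceTime :
    (volume : Measure (ℝ × Space)).IsAddLeftInvariant := by
  rw [Measure.volume_eq_prod]
  infer_instance

/-- Translations act continuously on `L²`. This carries the limit `h → 0`. -/
lemma continuous_integral_inner_translate {f g : ℝ × Space → Space} (hf : MemLp f 2 volume)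
    (hg : MemLp g 2 volume) :
    Continuous fun r : ℝ => ∫ p, inner ℝ (f (p - (r, 0))) (g p) := by
  let σ : ℝ → C(ℝ × Space, ℝ × Space) :=
    (ContinuousMap.mk (fun q : ℝ × (ℝ × Space) => q.2 - (q.1, 0)) (by fun_prop)).curry
  have hmp : ∀ r : ℝ, MeasurePreserving (σ r) volume volume := fun r =>
    measurePreserving_sub_right volume ((r, 0) : ℝ × Space)
  have hcont := (continuous_const (y := hf.toLp f)).compMeasurePreservingLp (f := fun _ : ℝ => hf.toLp f)
    (ContinuousMap.continuous _ : Continuous σ) hmp ENNReal.ofNat_ne_top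
  refine (hcont.inner (𝕜 := ℝ) (continuous_const (y := hg.toLp g))).congr fun r => ?_
  rw [Lp.toLp_compMeasurePreserving, inner_toLp_eq_integral]
  rfl

lemma sub_le_deriv_mul_sub {j : ℝ → ℝ} (hj : Differentiable ℝ j) (hmono : Monotone (deriv j))
    (a b : ℝ) : j a - j b ≤ deriv j a * (a - b) := by
  rcases lt_trichotomy a b with h | h | h
  · obtain ⟨c, hc, hd⟩ := exists_deriv_eq_slope j h hj.continuous.continuousOn hj.differentiableOn
    rw [eq_div_iff (by linarith)] at hd
    nlinarith [hmono hc.1.le]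
  · simp [h]
  · obtain ⟨c, hc, hd⟩ := exists_deriv_eq_slope j h hj.continuous.continuousOn hj.differentiableOn
    rw [eq_div_iff (by linarith)] at hd
    nlinarith [hmono hc.2.le]

lemma exists_bound_on_interval {f : ℝ → ℝ} (hf : Continuous f) (M : ℝ) :
    ∃ C, 0 ≤ C ∧ ∀ r, |r| ≤ M → |f r| ≤ C := by
  obtain ⟨C, hC⟩ := (isCompact_Icc (a := -M) (b := M)).exists_bound_of_continuousOn hf.continuousOn
  exact ⟨max C 0, le_max_right _ _, fun r hr => (hC r (abs_le.1 hr)).trans (le_max_left _ _)⟩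

/-- The integral telescopes to a difference of integrals of `Φ` over two windows of length `h`, so
the bound does not depend on `b`. -/
lemma neg_le_integral_sub_shift {Φ : ℝ → ℝ} {C : ℝ} (hΦ : Measurable Φ) (hC : ∀ t, |Φ t| ≤ C)
    {b h : ℝ} (hb : 1 < b) (hh : 0 < h) :
    -(2 * C * h) ≤ ∫ s in Ioc 1 b, (Φ s - Φ (s - h)) := by
  have hi : ∀ x y, IntervalIntegrable Φ volume x y := fun x y => by
    have : IntervalIntegrable (fun _ : ℝ => C) volume x y := intervalIntegrable_const
    exact this.mono_fun hΦ.aestronglyMeasurable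
      (Eventually.of_forall fun t => (hC t).trans (le_abs_self C))
  have hi' : IntervalIntegrable (fun s => Φ (s - h)) volume 1 b := by
    have : IntervalIntegrable (fun _ : ℝ => C) volume 1 b := intervalIntegrable_const
    exact this.mono_fun (hΦ.comp (measurable_id.sub_const h)).aestronglyMeasurable
      (Eventually.of_forall fun t => (hC _).trans (le_abs_self C))
  rw [← intervalIntegral.integral_of_le hb.le, intervalIntegral.integral_sub (hi _ _) hi',
    intervalIntegral.integral_comp_sub_right (fun s => Φ s),
    intervalIntegral.integral_interval_sub_interval_comm' (hi _ _) (hi _ _) (hi _ _)]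
  have h1 : ‖∫ x in (b - h)..b, Φ x‖ ≤ C * |b - (b - h)| :=
    intervalIntegral.norm_integral_le_of_norm_le_const fun x _ => hC x
  have h2 : ‖∫ x in (1 - h)..1, Φ x‖ ≤ C * |1 - (1 - h)| :=
    intervalIntegral.norm_integral_le_of_norm_le_const fun x _ => hC x
  simp only [sub_sub_cancel, abs_of_pos hh, Real.norm_eq_abs] at h1 h2
  linarith [neg_abs_le (∫ x in (b - h)..b, Φ x), le_abs_self (∫ x in (1 - h)..1, Φ x)]

lemma le_of_integral_averages {K : ℝ → ℝ} (hK : Continuous K) {c : ℝ}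
    (h : ∀ δ, 0 < δ → δ < 1 → c * δ ≤ ∫ r in Ioc 0 δ, K r) : c ≤ K 0 := by
  by_contra! hlt
  obtain ⟨m, hm1, hm2⟩ := exists_between hlt
  obtain ⟨ε, hε, hball⟩ := Metric.eventually_nhds_iff.1
    ((hK.tendsto 0).eventually (gt_mem_nhds hm1))
  set δ := min (ε / 2) (1 / 2) with hδ
  have hδ0 : 0 < δ := by positivity
  have h1 := h δ hδ0 ((min_le_right _ _).trans_lt (by norm_num))
  have h2 : ∫ r in Ioc 0 δ, K r ≤ ∫ _ in Ioc 0 δ, m := by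
    refine setIntegral_mono_on (hK.integrableOn_Ioc) (integrableOn_const (by simp)) measurableSet_Ioc
      fun r hr => (hball ?_).le
    rw [Real.dist_eq, sub_zero, abs_of_pos hr.1]
    linarith [hr.2, min_le_left (ε / 2) (1 / 2)]
  simp [hδ0.le] at h2
  nlinarith

namespace IsRegularSolution

variable {M : ℝ} {u : ℝ → Space → Space} {T : ℝ → Space → ℝ} {G : ℝ → Space → Space}

/-- The gradient of the test function `β(T) - β(1 - z)`. -/
noncomputable def testGradient (β : ℝ → ℝ) (T : ℝ → Space → ℝ) (G : ℝ → Space → Space) (p : ℝ × Space) : Space :=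
  deriv β (T p.1 p.2) • G p.1 p.2 + deriv β (1 - p.2 2) • unitVec 2

lemma memLp_testGradient (S : IsRegularSolution lx ly M u T G) {β : ℝ → ℝ}
    (hβ : ContDiff ℝ 1 β) (τ : ℝ) : MemLp (testGradient β T G) 2 (slab lx ly 0 τ) := by
  have hβ' := hβ.continuous_deriv le_rfl
  obtain ⟨C, hC0, hC⟩ := exists_bound_on_interval hβ' M
  refine MemLp.add (MemLp.of_le_mul (c := C) (S.memLp_G τ)
    ((hβ'.measurable.comp S.meas_T).smul S.meas_G).aestronglyMeasurable
    (Eventually.of_forall fun p => ?_)) ?_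
  · rw [norm_smul]
    gcongr
    exact hC _ (S.bdd _ _)
  · exact (memLp_of_continuous (f := fun x : Space => deriv β (1 - x 2) • unitVec 2)
      (by fun_prop) 2 lx ly).comp_snd _

/-- Testing the equation with `β(T) - β(1 - z)`, `β = j'`, for a smooth convex function `j`. -/
lemma exists_bound_integral_flux (S : IsRegularSolution lx ly M u T G) {j : ℝ → ℝ}
    (hj : ContDiff ℝ ∞ j) (hmono : Monotone (deriv j)) :
    ∃ C, ∀ b, 1 < b → -C ≤ ∫ p, inner ℝ (T p.1 p.2 • u p.1 p.2 - G p.1 p.2)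
      (testGradient (deriv j) T G p) ∂(slab lx ly 1 b) := by
  set β := deriv j with hβdef
  have hβ : ContDiff ℝ ∞ β := (contDiff_infty_iff_deriv.1 hj).2
  have hβ1 : ContDiff ℝ 1 β := hβ.of_le (by exact_mod_cast le_top)
  have hj1 : Differentiable ℝ j := (contDiff_infty_iff_deriv.1 hj).1
  set μ := cellMeasure lx ly with hμ
  obtain ⟨Cj, hCj0, hCj⟩ := exists_bound_on_interval hj.continuous M
  obtain ⟨Cβ, hCβ0, hCβ⟩ := exists_bound_on_interval hβ.continuous 1
  have hz : Measurable fun p : ℝ × Space => 1 - p.2 2 := by fun_prop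
  have hzc : Continuous fun x : Space => β (1 - x 2) := hβ.continuous.comp (by fun_prop)
  have hslice : ∀ t, Measurable (T t) := fun t => S.meas_T.comp measurable_prodMk_left
  have hzb : ∀ᵐ x ∂μ, |β (1 - x 2)| ≤ Cβ := by
    filter_upwards [ae_mem_cell lx ly] with x hx
    obtain ⟨-, -, hx0, hx1⟩ := hx
    exact hCβ _ (abs_le.2 ⟨by linarith, by linarith⟩)
  -- By convexity `j(a) - j(a') ≤ β(a)(a - a')`. Subtracting the term linear in `T`, increments of
  -- `Φ` are bounded by the increment of `T` paired with `β(T) - β(1 - z)`.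
  set Φ : ℝ → ℝ := fun t => ∫ x, (j (T t x) - β (1 - x 2) * T t x) ∂μ with hΦ
  have hΦm : Measurable Φ := by
    have : StronglyMeasurable fun p : ℝ × Space => j (T p.1 p.2) - β (1 - p.2 2) * T p.1 p.2 :=
      ((hj.continuous.measurable.comp S.meas_T).sub
        ((hβ.continuous.measurable.comp hz).mul S.meas_T)).stronglyMeasurable
    exact this.integral_prod_right.measurable
  have hpt : ∀ t, ∀ᵐ x ∂μ, ‖j (T t x) - β (1 - x 2) * T t x‖ ≤ Cj + Cβ * M := by
    intro t
    filter_upwards [hzb] with x hx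
    calc ‖j (T t x) - β (1 - x 2) * T t x‖ ≤ ‖j (T t x)‖ + ‖β (1 - x 2) * T t x‖ := norm_sub_le _ _
      _ ≤ Cj + Cβ * M := by
        rw [norm_mul]
        gcongr
        · exact hCj _ (S.bdd t x)
        · exact hx
        · exact S.bdd t x
  have hΦi : ∀ t, Integrable (fun x => j (T t x) - β (1 - x 2) * T t x) μ := fun t =>
    (integrable_const (Cj + Cβ * M)).mono'
      ((hj.continuous.measurable.comp (hslice t)).sub
        (hzc.measurable.mul (hslice t))).aestronglyMeasurable (hpt t)
  set C := (Cj + Cβ * M) * μ.real univ with hC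
  have hΦb : ∀ t, |Φ t| ≤ C := fun t => norm_integral_le_of_norm_le_const (hpt t)
  refine ⟨2 * C, fun b hb => ?_⟩
  set F : ℝ × Space → Space := fun p => T p.1 p.2 • u p.1 p.2 - G p.1 p.2 with hF
  set g := testGradient β T G with hg
  have hset : ∀ a, MeasurableSet (Ioc a b ×ˢ cell lx ly) := fun a =>
    measurableSet_Ioc.prod (measurableSet_cell lx ly)
  -- The flux is cut off to `(0, b]` but the test gradient to `(1, b]`: for `0 < r ≤ h < 1`,
  -- translating by `r` keeps `s - r` in `(0, b]`, so the cut-off of the flux is never felt.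
  set F' := (Ioc 0 b ×ˢ cell lx ly).indicator F with hF'
  set g' := (Ioc 1 b ×ˢ cell lx ly).indicator g with hg'
  have hF'L : MemLp F' 2 volume := by
    rw [hF', memLp_indicator_iff_restrict (hset 0), ← slab_eq_restrict]
    exact S.memLp_flux b
  have hg'L : MemLp g' 2 volume := by
    rw [hg', memLp_indicator_iff_restrict (hset 1), ← slab_eq_restrict]
    exact (S.memLp_testGradient hβ1 b).mono_measure
      (slab_mono (Ioc_subset_Ioc_left zero_le_one))
  set K : ℝ → ℝ := fun r => ∫ p, inner ℝ (F' (p - (r, 0))) (g' p) with hK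
  have hKc : Continuous K := continuous_integral_inner_translate hF'L hg'L
  have hK0 : K 0 = ∫ p, inner ℝ (F p) (g p) ∂(slab lx ly 1 b) := by
    rw [slab_eq_restrict, ← integral_indicator (hset 1)]
    refine integral_congr_ae (Eventually.of_forall fun p => ?_)
    have h0 : p - ((0 : ℝ), (0 : Space)) = p := by simp
    simp only [h0]
    by_cases hp : p ∈ Ioc 1 b ×ˢ cell lx ly
    · have hp' : p ∈ Ioc 0 b ×ˢ cell lx ly := ⟨Ioc_subset_Ioc_left zero_le_one hp.1, hp.2⟩
      simp only [hF', hg', indicator_of_mem hp, indicator_of_mem hp']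
    · simp only [hg', indicator_of_notMem hp, inner_zero_right]
  rw [← hK0]
  -- It suffices that the mean of `K` over `(0, h]` is at least `-2C` for every small `h`;
  -- continuity at zero concludes.
  refine le_of_integral_averages hKc fun h hh hh1 => ?_
  set ρ : Measure ℝ := volume.restrict (Ioc 0 h) with hρ
  have hinc : ∀ᵐ s, s ∈ Ioc 1 b → Φ s - Φ (s - h) ≤
      ∫ r in Ioc 0 h, ∫ x, inner ℝ (F (s - r, x)) (g (s, x)) ∂μ := by
    have hdir := (ae_restrict_iff' measurableSet_Ioi).1 S.dirichlet
    filter_upwards [S.ae_increment_pairing hh, hdir] with s hs1 hs2 hs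
    have hs0 : 0 < s := one_pos.trans hs.1
    have hH := (hs2 hs0).comp (S.bdd s) hβ
    refine le_of_le_of_eq ?_ (hs1 (hh1.trans hs.1) _ _ hH)
    rw [hΦ]
    simp only
    rw [← integral_sub (hΦi s) (hΦi (s - h))]
    have hTb : ∀ x, ‖T s x - T (s - h) x‖ ≤ 2 * M := fun x =>
      (norm_sub_le _ _).trans (by
        have h1 := S.bdd s x
        have h2 := S.bdd (s - h) x
        simp only [Real.norm_eq_abs]
        linarith)
    refine integral_mono ((hΦi s).sub (hΦi (s - h)))
      ((hH.1.integrable one_le_two).bdd_mul ((hslice s).sub (hslice (s - h))).aestronglyMeasurable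
        (Eventually.of_forall hTb)) fun x => ?_
    have := sub_le_deriv_mul_sub hj1 hmono (T s x) (T (s - h) x)
    simp only
    nlinarith
  have hshear := measurePreserving_shear (volume : Measure (ℝ × Space)) ρ
    (c := fun r => -((r, 0) : ℝ × Space)) (by fun_prop)
  have hFs : MemLp (fun q : ℝ × (ℝ × Space) => F' (q.2 - (q.1, 0))) 2 (ρ.prod volume) := by
    have := (hF'L.comp_snd ρ).comp_measurePreserving hshear
    simpa only [Function.comp_def, ← sub_eq_add_neg] using this
  have hA : Integrable (fun q : ℝ × (ℝ × Space) => inner ℝ (F' (q.2 - (q.1, 0))) (g' q.2))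
      (ρ.prod volume) := integrable_inner_of_memLp hFs (hg'L.comp_snd ρ)
  have hA' : Integrable (fun q : (ℝ × ℝ) × Space =>
      inner ℝ (F' ((q.1.2, q.2) - (q.1.1, 0))) (g' (q.1.2, q.2)))
      ((ρ.prod volume).prod (volume : Measure Space)) := by
    have hass := measurePreserving_prodAssoc ρ (volume : Measure ℝ) (volume : Measure Space)
    rw [Measure.volume_eq_prod] at hA
    exact (hass.integrable_comp hA.aestronglyMeasurable).2 hA
  have hk := hA'.integral_prod_left
  have hA2 : ∀ r, K r = ∫ s, ∫ x, inner ℝ (F' ((s, x) - (r, 0))) (g' (s, x)) := by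
    intro r
    have hmp : MeasurePreserving (fun p : ℝ × Space => p - (r, 0)) volume volume :=
      measurePreserving_sub_right _ _
    rw [hK]
    simp only
    rw [Measure.volume_eq_prod, integral_prod]
    rw [← Measure.volume_eq_prod]
    exact integrable_inner_of_memLp (hF'L.comp_measurePreserving hmp) hg'L
  have hpt' : ∀ s, (∫ r, ∫ x, inner ℝ (F' ((s, x) - (r, 0))) (g' (s, x)) ∂volume ∂ρ) =
      (Ioc 1 b).indicator
        (fun s => ∫ r in Ioc 0 h, ∫ x, inner ℝ (F (s - r, x)) (g (s, x)) ∂μ) s := by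
    intro s
    by_cases hs : s ∈ Ioc 1 b
    · rw [indicator_of_mem hs]
      refine setIntegral_congr_fun measurableSet_Ioc fun r hr => ?_
      simp only [hμ, cellMeasure]
      rw [← integral_indicator (measurableSet_cell lx ly)]
      refine integral_congr_ae (Eventually.of_forall fun x => ?_)
      have hsub : ((s, x) : ℝ × Space) - (r, 0) = (s - r, x) := by simp
      simp only [hsub]
      by_cases hx : x ∈ cell lx ly
      · have m1 : (s - r, x) ∈ Ioc 0 b ×ˢ cell lx ly :=
          ⟨⟨by simp only; linarith [hs.1, hr.2], by simp only; linarith [hs.2, hr.1]⟩, hx⟩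
        have m2 : (s, x) ∈ Ioc 1 b ×ˢ cell lx ly := ⟨hs, hx⟩
        simp only [hF', hg', indicator_of_mem m1, indicator_of_mem m2, indicator_of_mem hx]
      · have m2 : (s, x) ∉ Ioc 1 b ×ˢ cell lx ly := fun h' => hx h'.2
        simp only [hg', indicator_of_notMem m2, inner_zero_right, indicator_of_notMem hx]
    · have m2 : ∀ x, (s, x) ∉ Ioc 1 b ×ˢ cell lx ly := fun x h' => hs h'.1
      simp only [hg', indicator_of_notMem hs, indicator_of_notMem (m2 _), inner_zero_right,
        integral_zero]
  have hKint : ∫ r in Ioc 0 h, K r =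
      ∫ s in Ioc 1 b, ∫ r in Ioc 0 h, ∫ x, inner ℝ (F (s - r, x)) (g (s, x)) ∂μ := by
    simp only [hA2]
    rw [integral_integral_swap hk, ← integral_indicator measurableSet_Ioc]
    exact integral_congr_ae (Eventually.of_forall hpt')
  have hright : IntegrableOn (fun s => ∫ r in Ioc 0 h, ∫ x, inner ℝ (F (s - r, x)) (g (s, x)) ∂μ)
      (Ioc 1 b) :=
    (integrable_indicator_iff measurableSet_Ioc).1
      (hk.integral_prod_right.congr (Eventually.of_forall hpt'))
  have hleft : IntegrableOn (fun s => Φ s - Φ (s - h)) (Ioc 1 b) := by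
    refine Integrable.mono' (g := fun _ => 2 * C) (integrable_const _)
      (hΦm.sub (hΦm.comp (measurable_id.sub_const h))).aestronglyMeasurable
      (Eventually.of_forall fun s => ?_)
    refine (norm_sub_le _ _).trans ?_
    have h1 := hΦb s
    have h2 := hΦb (s - h)
    simp only [Real.norm_eq_abs]
    linarith
  have h1 := neg_le_integral_sub_shift hΦm hΦb hb hh
  have h2 := setIntegral_mono_on_ae hleft hright measurableSet_Ioc hinc
  rw [hKint]
  linarith

end IsRegularSolution

/-! ### The barrier for the range `[0, 1]`. -/

/-- A smooth nondecreasing function that vanishes exactly on `[0, 1]`. -/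
noncomputable def unitIntervalBarrier (r : ℝ) : ℝ := expNegInvGlue (r - 1) - expNegInvGlue (-r)

lemma contDiff_unitIntervalBarrier : ContDiff ℝ ∞ unitIntervalBarrier :=
  (expNegInvGlue.contDiff.comp (contDiff_id.sub contDiff_const)).sub
    (expNegInvGlue.contDiff.comp contDiff_neg)

lemma monotone_unitIntervalBarrier : Monotone unitIntervalBarrier := fun r s h =>
  sub_le_sub (expNegInvGlue.monotone (by linarith)) (expNegInvGlue.monotone (by linarith))

lemma unitIntervalBarrier_eq_zero {r : ℝ} (h0 : 0 ≤ r) (h1 : r ≤ 1) : unitIntervalBarrier r = 0 := by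
  rw [unitIntervalBarrier, expNegInvGlue.zero_of_nonpos (by linarith),
    expNegInvGlue.zero_of_nonpos (by linarith), sub_zero]

lemma deriv_unitIntervalBarrier_eq_zero {r : ℝ} (h0 : 0 < r) (h1 : r < 1) :
    deriv unitIntervalBarrier r = 0 := by
  have : unitIntervalBarrier =ᶠ[𝓝 r] fun _ => 0 := by
    filter_upwards [Ioo_mem_nhds h0 h1] with s hs
    exact unitIntervalBarrier_eq_zero hs.1.le hs.2.le
  rw [this.deriv_eq, deriv_const]

/-- Outside `[-ε, 1 + ε]` the barrier has absolute value at least `c = expNegInvGlue ε`, so with `K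
= (|M| + 1)/c` the last term alone exceeds `|r - 1/2|`. -/
lemma exists_abs_sub_half_le (M : ℝ) {ε : ℝ} (hε : 0 < ε) :
    ∃ K, 0 ≤ K ∧ ∀ r, |r| ≤ M → |r - 1 / 2| ≤ 1 / 2 + ε + K * |unitIntervalBarrier r| := by
  set c := expNegInvGlue ε with hc
  have hc0 : 0 < c := expNegInvGlue.pos_of_pos hε
  refine ⟨(|M| + 1) / c, by positivity, fun r hr => ?_⟩
  have hr' := abs_le.1 (hr.trans (le_abs_self M))
  have hbig : c ≤ |unitIntervalBarrier r| →
      |M| + 1 ≤ (|M| + 1) / c * |unitIntervalBarrier r| := fun h => by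
    calc |M| + 1 = (|M| + 1) / c * c := by field_simp
      _ ≤ _ := by gcongr
  rcases le_or_gt r (1 + ε) with h1 | h1
  · rcases le_or_gt (-ε) r with h2 | h2
    · have : 0 ≤ (|M| + 1) / c * |unitIntervalBarrier r| := by positivity
      rw [abs_le]
      constructor <;> linarith
    · have h3 : c ≤ |unitIntervalBarrier r| := by
        rw [unitIntervalBarrier, expNegInvGlue.zero_of_nonpos (x := r - 1) (by linarith), zero_sub,
          abs_neg]
        exact (expNegInvGlue.monotone (by linarith)).trans (le_abs_self _)
      have := hbig h3
      rw [abs_le]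
      constructor <;> linarith [hr'.1, hr'.2]
  · have h3 : c ≤ |unitIntervalBarrier r| := by
      rw [unitIntervalBarrier, expNegInvGlue.zero_of_nonpos (x := -r) (by linarith), sub_zero]
      exact (expNegInvGlue.monotone (by linarith)).trans (le_abs_self _)
    have := hbig h3
    rw [abs_le]
    constructor <;> linarith [hr'.1, hr'.2]

/-! ### Transport, entropy and energy estimates. -/

lemma isSmoothPeriodic_comp_vertical {B : ℝ → ℝ} (hB : ContDiff ℝ ∞ B) :
    IsSmoothPeriodic lx ly fun x => B (1 - x 2) := by
  refine ⟨hB.comp (contDiff_const.sub (EuclideanSpace.proj 2 : Space →L[ℝ] ℝ).contDiff),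
    fun x => ?_⟩
  simp [unitVec_apply]

lemma gradient_comp_vertical {B : ℝ → ℝ} (hB : ContDiff ℝ 1 B) (x : Space) :
    ∇ (fun x : Space => B (1 - x 2)) x = -(deriv B (1 - x 2) • unitVec 2) := by
  have h2 := ((hB.differentiable (by simp) (1 - x 2)).hasDerivAt).comp_hasFDerivAt x
    ((hasGradientAt_iff_hasFDerivAt.1 (hasGradientAt_vertical x)).const_sub 1)
  refine HasGradientAt.gradient ?_
  rw [hasGradientAt_iff_hasFDerivAt]
  refine h2.congr_fderiv ?_
  simp only [map_neg, map_smul, smul_neg]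

namespace IsRegularSolution

variable {M : ℝ} {u : ℝ → Space → Space} {T : ℝ → Space → ℝ} {G : ℝ → Space → Space}

/-- The integrand is `u · ∇B(T)`. The part `B(T) - B(1 - z)` lies in `H₀¹`, while `B(1 - z)` need
not vanish at the walls: for it the no-penetration condition is needed. -/
lemma ae_integral_transport_eq_zero (S : IsRegularSolution lx ly M u T G) {B : ℝ → ℝ}
    (hB : ContDiff ℝ ∞ B) : ∀ᵐ t ∂(volume.restrict (Ioi (0 : ℝ))),
      ∫ x, inner ℝ (u t x) (deriv B (T t x) • G t x) ∂(cellMeasure lx ly) = 0 := by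
  have hB1 : ContDiff ℝ 1 B := hB.of_le (by exact_mod_cast le_top)
  have hB' := hB1.continuous_deriv le_rfl
  filter_upwards [S.wall, S.dirichlet, ae_memLp_slice S.meas_u S.memLp_u] with t hw hd hu
  have hH := hd.comp (S.bdd t) hB
  have h1 := hH.integral_inner_eq_zero hu fun φ hφ => hw φ hφ.1
  have h2 := hw _ (isSmoothPeriodic_comp_vertical hB)
  simp only [gradient_comp_vertical hB1, inner_neg_right, integral_neg, neg_eq_zero] at h2
  have hc : MemLp (fun x : Space => deriv B (1 - x 2) • unitVec 2) 2 (cellMeasure lx ly) :=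
    memLp_of_continuous (by fun_prop) 2 lx ly
  have h3 : ∫ x, inner ℝ (u t x) (deriv B (T t x) • G t x) ∂(cellMeasure lx ly) =
      ∫ x, inner ℝ (u t x) (deriv B (T t x) • G t x + deriv B (1 - x 2) • unitVec 2)
        ∂(cellMeasure lx ly) - ∫ x, inner ℝ (u t x) (deriv B (1 - x 2) • unitVec 2)
        ∂(cellMeasure lx ly) := by
    rw [← integral_sub (integrable_inner_of_memLp hu hH.2.1) (integrable_inner_of_memLp hu hc)]
    refine integral_congr_ae (Eventually.of_forall fun x => ?_)
    simp only [inner_add_right, add_sub_cancel_right]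
  rw [h3, h1, h2, sub_zero]

lemma ae_slab_of_ae {P : ℝ → Prop} (h : ∀ᵐ t ∂(volume.restrict (Ioi (0 : ℝ))), P t) (b : ℝ) :
    ∀ᵐ t ∂(volume.restrict (Ioc 1 b)), P t :=
  ae_restrict_of_ae_restrict_of_subset (fun _ ht => one_pos.trans ht.1) h

lemma memLp_coeff_smul (S : IsRegularSolution lx ly M u T G) {c : ℝ → ℝ} (hc : Continuous c)
    {f : ℝ × Space → Space} (hf : Measurable f) {ν : Measure (ℝ × Space)} (hfL : MemLp f 2 ν) :
    MemLp (fun p => c (T p.1 p.2) • f p) 2 ν := by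
  obtain ⟨C, hC0, hC⟩ := exists_bound_on_interval hc M
  refine MemLp.of_le_mul (c := C) hfL
    ((hc.measurable.comp S.meas_T).smul hf).aestronglyMeasurable (Eventually.of_forall fun p => ?_)
  rw [norm_smul]
  gcongr
  exact hC _ (S.bdd _ _)

lemma memLp_u_slab (S : IsRegularSolution lx ly M u T G) (b : ℝ) :
    MemLp (fun p : ℝ × Space => u p.1 p.2) 2 (slab lx ly 1 b) :=
  (S.memLp_u b).mono_measure (slab_mono (Ioc_subset_Ioc_left zero_le_one))

lemma memLp_G_slab (S : IsRegularSolution lx ly M u T G) (b : ℝ) :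
    MemLp (fun p : ℝ × Space => G p.1 p.2) 2 (slab lx ly 1 b) :=
  (S.memLp_G b).mono_measure (slab_mono (Ioc_subset_Ioc_left zero_le_one))

lemma memLp_vertical_slab (c : Space → ℝ) (hc : Continuous c) (b : ℝ) :
    MemLp (fun p : ℝ × Space => c p.2 • unitVec 2) 2 (slab lx ly 1 b) :=
  (memLp_of_continuous (f := fun x => c x • unitVec 2) (by fun_prop) 2 lx ly).comp_snd _

lemma exists_bound_entropy (S : IsRegularSolution lx ly M u T G) {j : ℝ → ℝ}
    (hj : ContDiff ℝ ∞ j) (hmono : Monotone (deriv j)) :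
    ∃ C, ∀ b, 1 < b → ∫ p, (deriv (deriv j) (T p.1 p.2) * ‖G p.1 p.2‖ ^ 2 +
      (deriv (deriv j) (1 - p.2 2) * G p.1 p.2 2 -
        deriv (deriv j) (1 - p.2 2) * (T p.1 p.2 * u p.1 p.2 2))) ∂(slab lx ly 1 b) ≤ C := by
  obtain ⟨C, hC⟩ := S.exists_bound_integral_flux hj hmono
  refine ⟨C, fun b hb => ?_⟩
  set β := deriv j with hβdef
  have hβ : ContDiff ℝ ∞ β := (contDiff_infty_iff_deriv.1 hj).2
  have hβ' : ContDiff ℝ ∞ (deriv β) := (contDiff_infty_iff_deriv.1 hβ).2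
  have hβc := hβ'.continuous
  -- Chosen so that `T β'(T) ∇T = ∇B(T)`: the convective term becomes a pure transport term and
  -- integrates to zero.
  set B : ℝ → ℝ := fun y => ∫ r in (0 : ℝ)..y, r * deriv β r with hB
  have hBs : ContDiff ℝ ∞ B := contDiff_primitive (contDiff_id.mul hβ')
  have hBd : deriv B = fun r => r * deriv β r := funext fun r =>
    (hasDerivAt_primitive (continuous_id.mul hβc) r).deriv
  have hu := S.memLp_u_slab b
  have hG := S.memLp_G_slab b
  have hBG : MemLp (fun p : ℝ × Space => deriv B (T p.1 p.2) • G p.1 p.2) 2 (slab lx ly 1 b) :=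
    S.memLp_coeff_smul ((contDiff_infty_iff_deriv.1 hBs).2.continuous) S.meas_G hG
  have hi1 := integrable_inner_of_memLp hu hBG
  have hz : ∫ p, inner ℝ (u p.1 p.2) (deriv B (T p.1 p.2) • G p.1 p.2) ∂(slab lx ly 1 b) = 0 := by
    rw [slab] at hi1 ⊢
    rw [integral_prod _ hi1]
    refine integral_eq_zero_of_ae ?_
    filter_upwards [ae_slab_of_ae (S.ae_integral_transport_eq_zero hBs) b] with t ht
    exact ht
  have hvert := memLp_vertical_slab (lx := lx) (ly := ly) (fun x => deriv β (1 - x 2))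
    (hβc.comp (by fun_prop)) b
  have hTu : MemLp (fun p : ℝ × Space => T p.1 p.2 • u p.1 p.2) 2 (slab lx ly 1 b) :=
    S.memLp_coeff_smul continuous_id S.meas_u hu
  have hβG : MemLp (fun p : ℝ × Space => deriv β (T p.1 p.2) • G p.1 p.2) 2 (slab lx ly 1 b) :=
    S.memLp_coeff_smul hβc S.meas_G hG
  have hi2 : Integrable (fun p : ℝ × Space => deriv β (T p.1 p.2) * ‖G p.1 p.2‖ ^ 2 +
      (deriv β (1 - p.2 2) * G p.1 p.2 2 - deriv β (1 - p.2 2) * (T p.1 p.2 * u p.1 p.2 2)))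
      (slab lx ly 1 b) := by
    refine ((integrable_inner_of_memLp hβG hG).add ((integrable_inner_of_memLp hG hvert).sub
      (integrable_inner_of_memLp hTu hvert))).congr (Eventually.of_forall fun p => ?_)
    simp [real_inner_smul_left, real_inner_smul_right, inner_unitVec]
  have hsplit : ∫ p, inner ℝ (T p.1 p.2 • u p.1 p.2 - G p.1 p.2) (testGradient β T G p)
      ∂(slab lx ly 1 b) = ∫ p, inner ℝ (u p.1 p.2) (deriv B (T p.1 p.2) • G p.1 p.2)
        ∂(slab lx ly 1 b) - ∫ p, (deriv β (T p.1 p.2) * ‖G p.1 p.2‖ ^ 2 +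
      (deriv β (1 - p.2 2) * G p.1 p.2 2 - deriv β (1 - p.2 2) * (T p.1 p.2 * u p.1 p.2 2)))
        ∂(slab lx ly 1 b) := by
    rw [← integral_sub hi1 hi2]
    refine integral_congr_ae (Eventually.of_forall fun p => ?_)
    simp only [testGradient, inner_sub_left, inner_add_right, real_inner_smul_left,
      real_inner_smul_right, inner_unitVec, real_inner_self_eq_norm_sq, hBd]
    ring
  have := hC b hb
  rw [hsplit, hz] at this
  linarith

/-- Inside the cell `1 - z` lies in `(0, 1)`, where `γ` and `γ'` vanish. So `γ(T)` itself is in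
`H₀¹` and the entropy bound reduces to `∫∫ γ'(T)|∇T|² ≤ C`. Poincaré and `γ'² ≤ L γ'` then give
`4LC`. -/
lemma exists_bound_barrier (hlx : 0 < lx) (hly : 0 < ly) (S : IsRegularSolution lx ly M u T G) :
    ∃ C, ∀ b, 1 < b → ∫ p, unitIntervalBarrier (T p.1 p.2) ^ 2 ∂(slab lx ly 1 b) ≤ C := by
  set γ := unitIntervalBarrier with hγ
  have hγs : ContDiff ℝ ∞ γ := contDiff_unitIntervalBarrier
  have hγ' : Continuous (deriv γ) := (contDiff_infty_iff_deriv.1 hγs).2.continuous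
  have hjd : deriv (fun y => ∫ r in (0 : ℝ)..y, γ r) = γ := funext fun r =>
    (hasDerivAt_primitive hγs.continuous r).deriv
  obtain ⟨C, hC⟩ := S.exists_bound_entropy (contDiff_primitive hγs)
    (by rw [hjd]; exact monotone_unitIntervalBarrier)
  rw [hjd] at hC
  obtain ⟨L, hL0, hL⟩ := exists_bound_on_interval hγ' M
  have hpos : ∀ r, 0 ≤ deriv γ r := fun r => monotone_unitIntervalBarrier.deriv_nonneg
  refine ⟨4 * L * C, fun b hb => ?_⟩
  have hG := S.memLp_G_slab b
  have hγG : MemLp (fun p : ℝ × Space => deriv γ (T p.1 p.2) • G p.1 p.2) 2 (slab lx ly 1 b) :=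
    S.memLp_coeff_smul hγ' S.meas_G hG
  have hi : Integrable (fun p : ℝ × Space => deriv γ (T p.1 p.2) * ‖G p.1 p.2‖ ^ 2)
      (slab lx ly 1 b) := by
    refine (integrable_inner_of_memLp hγG hG).congr (Eventually.of_forall fun p => ?_)
    simp [real_inner_smul_left]
  have hle : ∫ p, deriv γ (T p.1 p.2) * ‖G p.1 p.2‖ ^ 2 ∂(slab lx ly 1 b) ≤ C := by
    refine le_of_eq_of_le (integral_congr_ae ?_) (hC b hb)
    have hcell : ∀ᵐ p ∂(slab lx ly 1 b), p.2 ∈ cell lx ly := by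
      rw [slab_eq_restrict]
      filter_upwards [ae_restrict_mem (measurableSet_Ioc.prod (measurableSet_cell lx ly))] with p hp
      exact hp.2
    filter_upwards [hcell] with p hp
    obtain ⟨-, -, h0, h1⟩ := hp
    rw [hγ, deriv_unitIntervalBarrier_eq_zero (r := 1 - p.2 2) (by linarith) (by linarith)]
    ring
  obtain ⟨Cγ, -, hCγ⟩ := exists_bound_on_interval hγs.continuous M
  have hiγ : Integrable (fun p : ℝ × Space => γ (T p.1 p.2) ^ 2) (slab lx ly 1 b) := by
    refine (integrable_const (Cγ ^ 2)).mono'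
      ((hγs.continuous.measurable.comp S.meas_T).pow_const 2).aestronglyMeasurable
      (Eventually.of_forall fun p => ?_)
    rw [norm_pow]
    gcongr
    exact hCγ _ (S.bdd _ _)
  rw [slab] at hi hle hiγ ⊢
  rw [integral_prod _ hi] at hle
  rw [integral_prod _ hiγ]
  calc _ ≤ ∫ t in Ioc 1 b, 4 * L * ∫ x, deriv γ (T t x) * ‖G t x‖ ^ 2 ∂(cellMeasure lx ly) := by
        refine integral_mono_ae hiγ.integral_prod_left (hi.integral_prod_left.const_mul _) ?_
        filter_upwards [ae_slab_of_ae S.dirichlet b, hi.prod_right_ae] with t ht hit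
        have hH := ht.comp (S.bdd t) hγs
        have hH' := hH.congr (θ' := fun x => γ (T t x)) (g' := fun x => deriv γ (T t x) • G t x)
          (by
            filter_upwards [ae_mem_cell lx ly] with x hx
            obtain ⟨-, -, h0, h1⟩ := hx
            rw [hγ, unitIntervalBarrier_eq_zero (r := 1 - x 2) (by linarith) (by linarith), sub_zero])
          (by
            filter_upwards [ae_mem_cell lx ly] with x hx
            obtain ⟨-, -, h0, h1⟩ := hx
            rw [hγ, deriv_unitIntervalBarrier_eq_zero (r := 1 - x 2) (by linarith) (by linarith),
              zero_smul, add_zero])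
        have hp := hH'.poincare hlx hly
        simp only [Real.norm_eq_abs, sq_abs] at hp
        refine hp.trans ?_
        rw [mul_assoc, ← integral_const_mul L]
        refine mul_le_mul_of_nonneg_left (integral_mono ?_ (hit.const_mul L) fun x => ?_)
          (by norm_num)
        · exact hH'.2.1.integrable_norm_pow two_ne_zero
        · simp only [norm_smul, mul_pow, Real.norm_eq_abs, sq_abs]
          have h1 := (le_abs_self _).trans (hL _ (S.bdd t x))
          have h2 := hpos (T t x)
          have h3 : deriv γ (T t x) ^ 2 ≤ L * deriv γ (T t x) := by nlinarith
          rw [← mul_assoc]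
          exact mul_le_mul_of_nonneg_right h3 (by positivity)
    _ ≤ 4 * L * C := by
        rw [integral_const_mul]
        exact mul_le_mul_of_nonneg_left hle (by positivity)

lemma exists_bound_energy (hlx : 0 < lx) (hly : 0 < ly) (S : IsRegularSolution lx ly M u T G) :
    ∃ C, ∀ b, 1 < b → ∫ p, ‖G p.1 p.2‖ ^ 2 ∂(slab lx ly 1 b) ≤
      C + (slab lx ly 1 b).real univ + ∫ p, (T p.1 p.2 - 1 / 2) * u p.1 p.2 2 ∂(slab lx ly 1 b) := by
  have hjd : deriv (fun y : ℝ => y ^ 2 / 2) = id := funext fun r => by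
    simp [deriv_div_const]
  -- For this `j` one has `j' = id`, so the test function is `T - (1 - z)`.
  obtain ⟨C, hC⟩ := S.exists_bound_entropy (j := fun y => y ^ 2 / 2)
    ((contDiff_id.pow 2).div_const 2) (by rw [hjd]; exact monotone_id)
  rw [hjd] at hC
  simp only [deriv_id, one_mul] at hC
  refine ⟨C, fun b hb => ?_⟩
  have hu := S.memLp_u_slab b
  have hG := S.memLp_G_slab b
  have hv : MemLp (fun _ : ℝ × Space => unitVec 2) 2 (slab lx ly 1 b) := memLp_const _
  have hTu : MemLp (fun p : ℝ × Space => T p.1 p.2 • u p.1 p.2) 2 (slab lx ly 1 b) :=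
    S.memLp_coeff_smul continuous_id S.meas_u hu
  have i1 : Integrable (fun p : ℝ × Space => ‖G p.1 p.2‖ ^ 2) (slab lx ly 1 b) :=
    hG.integrable_norm_pow two_ne_zero
  have i2 : Integrable (fun p : ℝ × Space => G p.1 p.2 2) (slab lx ly 1 b) := by
    simpa only [inner_unitVec] using integrable_inner_of_memLp hG hv
  have i3 : Integrable (fun p : ℝ × Space => T p.1 p.2 * u p.1 p.2 2) (slab lx ly 1 b) := by
    simpa only [inner_unitVec, real_inner_smul_left] using integrable_inner_of_memLp hTu hv
  have i4 : Integrable (fun p : ℝ × Space => u p.1 p.2 2) (slab lx ly 1 b) := by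
    simpa only [inner_unitVec] using integrable_inner_of_memLp hu hv
  -- The field `G + e_z` is the gradient of an element of `H₀¹`, so its vertical component has mean
  -- zero.
  have hG2 : ∫ p, G p.1 p.2 2 ∂(slab lx ly 1 b) = -(slab lx ly 1 b).real univ := by
    have hone : ∫ p, (G p.1 p.2 2 + 1) ∂(slab lx ly 1 b) = 0 := by
      have i5 := i2.add (integrable_const (1 : ℝ))
      rw [slab] at i5 ⊢
      refine (integral_prod _ i5).trans (integral_eq_zero_of_ae ?_)
      filter_upwards [ae_slab_of_ae S.dirichlet b] with t ht
      simpa [unitVec_apply] using ht.integral_vertical_eq_zero hlx hly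
    rw [integral_add i2 (integrable_const _)] at hone
    simp only [integral_const, smul_eq_mul, mul_one] at hone
    linarith
  -- Testing no-penetration with `1 - z` gives `∫ w = 0` at almost every time.
  have hu2 : ∫ p, u p.1 p.2 2 ∂(slab lx ly 1 b) = 0 := by
    rw [slab] at i4 ⊢
    rw [integral_prod _ i4]
    refine integral_eq_zero_of_ae ?_
    filter_upwards [ae_slab_of_ae S.wall b] with t ht
    have := ht _ (isSmoothPeriodic_comp_vertical (lx := lx) (ly := ly) contDiff_id)
    simp only [gradient_comp_vertical contDiff_id] at this
    simpa [inner_unitVec, integral_neg] using this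
  have h1 := hC b hb
  have i23 : Integrable (fun p : ℝ × Space => G p.1 p.2 2 - T p.1 p.2 * u p.1 p.2 2)
    (slab lx ly 1 b) := i2.sub i3
  rw [integral_add i1 i23, integral_sub i2 i3, hG2] at h1
  have h2 : ∫ p, (T p.1 p.2 - 1 / 2) * u p.1 p.2 2 ∂(slab lx ly 1 b) =
      ∫ p, T p.1 p.2 * u p.1 p.2 2 ∂(slab lx ly 1 b) := by
    simp only [sub_mul]
    rw [integral_sub i3 (i4.const_mul _), integral_const_mul, hu2]
    simp
  rw [h2]
  linarith

/-- The parameter `s` stands for the root mean square of `w`: when `w²` has mean `s²`, the terms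
`s/4` and `w²/(4s)` add up to `s/2`, as sharp as Cauchy–Schwarz. Splitting by Young's inequality
keeps everything linear in integrals over the slab. -/
lemma exists_bound_dissipation (hlx : 0 < lx) (hly : 0 < ly)
    (S : IsRegularSolution lx ly M u T G) {s ε : ℝ} (hs : 0 < s) (hε : 0 < ε) :
    ∃ C, ∀ b, 1 < b → ∫ p, ‖G p.1 p.2‖ ^ 2 ∂(slab lx ly 1 b) ≤
      C + (1 + s / 4 + ε) * (slab lx ly 1 b).real univ +
        (1 / (4 * s) + 2 * ε) * ∫ p, u p.1 p.2 2 ^ 2 ∂(slab lx ly 1 b) := by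
  obtain ⟨C₁, hC₁⟩ := S.exists_bound_energy hlx hly
  obtain ⟨C₂, hC₂⟩ := S.exists_bound_barrier hlx hly
  obtain ⟨K, hK0, hK⟩ := exists_abs_sub_half_le M hε
  refine ⟨C₁ + K ^ 2 / (4 * ε) * C₂, fun b hb => (hC₁ b hb).trans ?_⟩
  have hu := S.memLp_u_slab b
  have hv : MemLp (fun _ : ℝ × Space => unitVec 2) 2 (slab lx ly 1 b) := memLp_const _
  have m2 : Measurable fun p : ℝ × Space => u p.1 p.2 2 :=
    (by fun_prop : Measurable fun v : Space => v 2).comp S.meas_u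
  have hu2 : MemLp (fun p : ℝ × Space => u p.1 p.2 2) 2 (slab lx ly 1 b) :=
    hu.of_le m2.aestronglyMeasurable (Eventually.of_forall fun p => PiLp.norm_apply_le _ 2)
  have i1 : Integrable (fun p : ℝ × Space => u p.1 p.2 2 ^ 2) (slab lx ly 1 b) := hu2.integrable_sq
  obtain ⟨Cγ, -, hCγ⟩ := exists_bound_on_interval contDiff_unitIntervalBarrier.continuous M
  have i2 : Integrable (fun p : ℝ × Space => unitIntervalBarrier (T p.1 p.2) ^ 2)
      (slab lx ly 1 b) := by
    refine (integrable_const (Cγ ^ 2)).mono'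
      ((contDiff_unitIntervalBarrier.continuous.measurable.comp S.meas_T).pow_const
        2).aestronglyMeasurable (Eventually.of_forall fun p => ?_)
    rw [norm_pow]
    gcongr
    exact hCγ _ (S.bdd _ _)
  have i3 : Integrable (fun p : ℝ × Space => (T p.1 p.2 - 1 / 2) * u p.1 p.2 2)
      (slab lx ly 1 b) :=
    (hu2.integrable one_le_two).bdd_mul (c := M + 1 / 2)
      (S.meas_T.sub_const _).aestronglyMeasurable (Eventually.of_forall fun p => by
        refine (norm_sub_le _ _).trans ?_
        have := S.bdd p.1 p.2
        norm_num
        linarith)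
  have hle : ∫ p, (T p.1 p.2 - 1 / 2) * u p.1 p.2 2 ∂(slab lx ly 1 b) ≤
      ∫ p, ((s / 4 + ε) + ((1 / (4 * s) + 2 * ε) * u p.1 p.2 2 ^ 2 +
        K ^ 2 / (4 * ε) * unitIntervalBarrier (T p.1 p.2) ^ 2)) ∂(slab lx ly 1 b) := by
    refine integral_mono i3 ((integrable_const _).add ((i1.const_mul _).add (i2.const_mul _)))
      fun p => ?_
    have h1 := hK _ (S.bdd p.1 p.2)
    set w := u p.1 p.2 2
    set γ := unitIntervalBarrier (T p.1 p.2)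
    simp only
    have h2 : (T p.1 p.2 - 1 / 2) * w ≤ (1 / 2 + ε + K * |γ|) * |w| := by
      refine (le_abs_self _).trans ?_
      rw [abs_mul]
      gcongr
    have h3 : 1 / 2 * |w| ≤ s / 4 + 1 / (4 * s) * w ^ 2 := by
      rw [← sq_abs w]
      have : s / 4 + 1 / (4 * s) * |w| ^ 2 - 1 / 2 * |w| = (|w| - s) ^ 2 / (4 * s) := by
        field_simp
        ring
      have h4 : 0 ≤ (|w| - s) ^ 2 / (4 * s) := by positivity
      linarith
    have h5 : ε * |w| ≤ ε + ε * w ^ 2 := by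
      rw [← sq_abs w]
      nlinarith [sq_nonneg (|w| - 1), abs_nonneg w]
    have h6 : K * |γ| * |w| ≤ ε * w ^ 2 + K ^ 2 / (4 * ε) * γ ^ 2 := by
      rw [← sq_abs w, ← sq_abs γ]
      have : ε * |w| ^ 2 + K ^ 2 / (4 * ε) * |γ| ^ 2 - K * |γ| * |w| =
          (2 * ε * |w| - K * |γ|) ^ 2 / (4 * ε) := by
        field_simp
        ring
      have h4 : 0 ≤ (2 * ε * |w| - K * |γ|) ^ 2 / (4 * ε) := by positivity
      linarith
    calc _ ≤ _ := h2
      _ = 1 / 2 * |w| + ε * |w| + K * |γ| * |w| := by ring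
      _ ≤ _ := by linarith
  have i12 : Integrable (fun p : ℝ × Space => (1 / (4 * s) + 2 * ε) * u p.1 p.2 2 ^ 2 +
        K ^ 2 / (4 * ε) * unitIntervalBarrier (T p.1 p.2) ^ 2) (slab lx ly 1 b) :=
    (i1.const_mul _).add (i2.const_mul _)
  rw [integral_add (integrable_const _) i12, integral_add (i1.const_mul _) (i2.const_mul _),
    integral_const_mul, integral_const_mul, integral_const, smul_eq_mul] at hle
  have h7 : K ^ 2 / (4 * ε) * ∫ p, unitIntervalBarrier (T p.1 p.2) ^ 2 ∂(slab lx ly 1 b) ≤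
      K ^ 2 / (4 * ε) * C₂ := mul_le_mul_of_nonneg_left (hC₂ b hb) (by positivity)
  linarith

end IsRegularSolution

/-! ### Long-time averages. -/

lemma longTimeAverage_congr {f f' : ℝ → Space → ℝ≥0∞}
    (h : ∀ᵐ t ∂(volume.restrict (Ioi (0 : ℝ))), ∀ᵐ x ∂(cellMeasure lx ly), f t x = f' t x) :
    longTimeAverage lx ly f = longTimeAverage lx ly f' := by
  unfold longTimeAverage
  congr 1
  funext τ
  refine laverage_congr ?_
  filter_upwards [ae_restrict_of_ae_restrict_of_subset
    (Ioc_subset_Ioi_self : Ioc (0 : ℝ) τ ⊆ Ioi 0) h] with t ht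
  exact laverage_congr ht

lemma longTimeAverage_mono {f f' : ℝ → Space → ℝ≥0∞} (h : ∀ t x, f t x ≤ f' t x) :
    longTimeAverage lx ly f ≤ longTimeAverage lx ly f' := by
  refine limsup_le_limsup (Eventually.of_forall fun τ => ?_)
  exact lintegral_mono fun t => lintegral_mono fun x => h t x

lemma average_eq_div (hlx : 0 < lx) (hly : 0 < ly) (f : ℝ → Space → ℝ≥0∞) {τ : ℝ} (hτ : 0 < τ) :
    (⨍⁻ t in Ioc 0 τ, (⨍⁻ x in cell lx ly, f t x ∂volume) ∂volume) =
      (∫⁻ t in Ioc 0 τ, ∫⁻ x, f t x ∂(cellMeasure lx ly)) /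
        ENNReal.ofReal (τ * volume.real (cell lx ly)) := by
  have h0 := (volume_cell_pos hlx hly).ne'
  have h1 := (volume_cell_lt_top lx ly).ne
  simp only [setLAverage_eq, div_eq_mul_inv]
  rw [lintegral_mul_const' _ _ (ENNReal.inv_ne_top.2 h0), ENNReal.ofReal_mul hτ.le,
    ofReal_measureReal h1, Real.volume_Ioc, sub_zero, mul_assoc,
    ENNReal.mul_inv (Or.inr h1) (Or.inr h0), mul_comm (volume (cell lx ly))⁻¹]
  rfl

/-- A finite limit superior makes the average finite at some time later than `τ`, which bounds the
integral up to `τ`. -/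
lemma lintegral_slab_lt_top (hlx : 0 < lx) (hly : 0 < ly) {f : ℝ → Space → ℝ≥0∞}
    (h : longTimeAverage lx ly f < ⊤) (τ : ℝ) :
    ∫⁻ t in Ioc 0 τ, ∫⁻ x, f t x ∂(cellMeasure lx ly) < ⊤ := by
  have h1 := eventually_lt_of_limsup_lt h
  obtain ⟨σ, hσ, hσ1, hσ0⟩ := (h1.and ((eventually_ge_atTop τ).and (eventually_gt_atTop 0))).exists
  rw [average_eq_div hlx hly f hσ0] at hσ
  have hle : ∫⁻ t in Ioc 0 τ, ∫⁻ x, f t x ∂(cellMeasure lx ly) ≤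
      ∫⁻ t in Ioc 0 σ, ∫⁻ x, f t x ∂(cellMeasure lx ly) :=
    lintegral_mono_set (Ioc_subset_Ioc_right hσ1)
  refine hle.trans_lt ?_
  by_contra htop
  rw [not_lt, top_le_iff] at htop
  rw [htop, ENNReal.top_div_of_ne_top ENNReal.ofReal_ne_top] at hσ
  exact lt_irrefl _ hσ

lemma memLp_slab_of_lintegral {E : Type*} [NormedAddCommGroup E] [MeasurableSpace E] [BorelSpace E]
    [SecondCountableTopology E] {f : ℝ → Space → E} (hf : Measurable fun p : ℝ × Space => f p.1 p.2)
    {τ : ℝ} (h : ∫⁻ t in Ioc 0 τ, ∫⁻ x, ‖f t x‖ₑ ^ 2 ∂(cellMeasure lx ly) < ⊤) :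
    MemLp (fun p : ℝ × Space => f p.1 p.2) 2 (slab lx ly 0 τ) := by
  refine ⟨hf.aestronglyMeasurable, ?_⟩
  rw [eLpNorm_lt_top_iff_lintegral_rpow_enorm_lt_top two_ne_zero ENNReal.ofNat_ne_top]
  simp only [ENNReal.toReal_ofNat, ENNReal.rpow_ofNat]
  rw [slab, lintegral_prod _ (hf.enorm.pow_const 2).aemeasurable]
  exact h

lemma average_sq_eq_ofReal (hlx : 0 < lx) (hly : 0 < ly) {E : Type*} [NormedAddCommGroup E]
    [MeasurableSpace E] [BorelSpace E] [SecondCountableTopology E] {f : ℝ → Space → E}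
    (hf : Measurable fun p : ℝ × Space => f p.1 p.2) {τ : ℝ} (hτ : 0 < τ)
    (h : MemLp (fun p : ℝ × Space => f p.1 p.2) 2 (slab lx ly 0 τ)) :
    (⨍⁻ t in Ioc 0 τ, (⨍⁻ x in cell lx ly, ‖f t x‖ₑ ^ 2 ∂volume) ∂volume) =
      ENNReal.ofReal ((∫ p, ‖f p.1 p.2‖ ^ 2 ∂(slab lx ly 0 τ)) /
        (τ * volume.real (cell lx ly))) := by
  have hV : 0 < volume.real (cell lx ly) :=
    ENNReal.toReal_pos (volume_cell_pos hlx hly).ne' (volume_cell_lt_top lx ly).ne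
  rw [average_eq_div hlx hly _ hτ, ENNReal.ofReal_div_of_pos (by positivity),
    ofReal_integral_eq_lintegral_ofReal (h.integrable_norm_pow two_ne_zero)
      (Eventually.of_forall fun p => by positivity)]
  congr 1
  have : ∀ p : ℝ × Space, ENNReal.ofReal (‖f p.1 p.2‖ ^ 2) = ‖f p.1 p.2‖ₑ ^ 2 := fun p => by
    rw [ENNReal.ofReal_pow (norm_nonneg _), ofReal_norm]
  simp only [this]
  rw [slab, lintegral_prod _ (hf.enorm.pow_const 2).aemeasurable]

lemma slab_real_univ (lx ly : ℝ) {a b : ℝ} (h : a ≤ b) :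
    (slab lx ly a b).real univ = (b - a) * volume.real (cell lx ly) := by
  rw [Measure.real, slab, ← univ_prod_univ, Measure.prod_prod, ENNReal.toReal_mul]
  simp [cellMeasure, Measure.real, h]

lemma integral_slab_split {f : ℝ × Space → ℝ} {b : ℝ} (hb : 1 ≤ b)
    (hf : Integrable f (slab lx ly 0 b)) :
    ∫ p, f p ∂(slab lx ly 0 b) = ∫ p, f p ∂(slab lx ly 0 1) + ∫ p, f p ∂(slab lx ly 1 b) := by
  simp only [slab_eq_restrict] at hf ⊢
  have hu : Ioc (0 : ℝ) b ×ˢ cell lx ly = Ioc 0 1 ×ˢ cell lx ly ∪ Ioc 1 b ×ˢ cell lx ly := by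
    rw [← union_prod, Ioc_union_Ioc_eq_Ioc zero_le_one hb]
  rw [hu] at hf ⊢
  refine setIntegral_union (Disjoint.set_prod_left ?_ _ _)
    (measurableSet_Ioc.prod (measurableSet_cell lx ly)) (IntegrableOn.left_of_union hf)
    (IntegrableOn.right_of_union hf)
  exact Ioc_disjoint_Ioc_of_le le_rfl

namespace IsRegularSolution

variable {M : ℝ} {u : ℝ → Space → Space} {T : ℝ → Space → ℝ} {G : ℝ → Space → Space}

lemma nusselt_le_of_lt (hlx : 0 < lx) (hly : 0 < ly) (S : IsRegularSolution lx ly M u T G)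
    {s ε : ℝ} (hs : 0 < s) (hε : 0 < ε)
    (hw : longTimeAverage lx ly (fun t x => ‖u t x 2‖ₑ ^ 2) < ENNReal.ofReal (s ^ 2)) :
    nusselt lx ly G ≤ ENNReal.ofReal (1 + s / 2 + ε * (2 + 2 * s ^ 2)) := by
  obtain ⟨C, hC⟩ := S.exists_bound_dissipation hlx hly hs hε
  set V := volume.real (cell lx ly) with hVdef
  have hV : 0 < V :=
    ENNReal.toReal_pos (volume_cell_pos hlx hly).ne' (volume_cell_lt_top lx ly).ne
  have m2 : Measurable fun p : ℝ × Space => u p.1 p.2 2 :=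
    (by fun_prop : Measurable fun v : Space => v 2).comp S.meas_u
  have hw2 : ∀ τ, MemLp (fun p : ℝ × Space => u p.1 p.2 2) 2 (slab lx ly 0 τ) := fun τ =>
    (S.memLp_u τ).of_le m2.aestronglyMeasurable
      (Eventually.of_forall fun p => PiLp.norm_apply_le _ 2)
  set E₁ := ∫ p, ‖G p.1 p.2‖ ^ 2 ∂(slab lx ly 0 1) with hE₁
  refine limsup_le_of_le (by isBoundedDefault) ?_
  -- From this time on, the dissipation on `(0, 1]` and the constant `C` together contribute at most
  -- `ε` to the average.
  have hlarge : ∀ᶠ τ : ℝ in atTop, (E₁ + C) / (ε * V) ≤ τ := eventually_ge_atTop _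
  filter_upwards [eventually_lt_of_limsup_lt hw, eventually_gt_atTop 1, hlarge] with τ h1 hτ1 h2
  have hτ : 0 < τ := one_pos.trans hτ1
  rw [average_sq_eq_ofReal hlx hly (f := fun t x => u t x 2) m2 hτ (hw2 τ)] at h1
  rw [average_sq_eq_ofReal hlx hly S.meas_G hτ (S.memLp_G τ)]
  refine ENNReal.ofReal_le_ofReal ?_
  have h3 := (ENNReal.ofReal_lt_ofReal_iff (by positivity)).1 h1
  rw [div_lt_iff₀ (by positivity)] at h3
  rw [div_le_iff₀ (by positivity), integral_slab_split hτ1.le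
    ((S.memLp_G τ).integrable_norm_pow two_ne_zero)]
  have h4 := hC τ hτ1
  rw [slab_real_univ lx ly hτ1.le] at h4
  rw [div_le_iff₀ (by positivity)] at h2
  have h5 : ∫ p, u p.1 p.2 2 ^ 2 ∂(slab lx ly 1 τ) ≤ s ^ 2 * (τ * V) := by
    refine le_trans ?_ h3.le
    simp only [Real.norm_eq_abs, sq_abs]
    exact integral_mono_measure (slab_mono (Ioc_subset_Ioc_left zero_le_one))
      (Eventually.of_forall fun p => sq_nonneg _) (hw2 τ).integrable_sq
  have h6 : (1 / (4 * s) + 2 * ε) * ∫ p, u p.1 p.2 2 ^ 2 ∂(slab lx ly 1 τ) ≤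
      (1 / (4 * s) + 2 * ε) * (s ^ 2 * (τ * V)) := mul_le_mul_of_nonneg_left h5 (by positivity)
  have h7 : (1 / (4 * s) + 2 * ε) * (s ^ 2 * (τ * V)) = (s / 4 + 2 * ε * s ^ 2) * (τ * V) := by
    field_simp
  have h8 : (1 + s / 4 + ε) * ((τ - 1) * V) ≤ (1 + s / 4 + ε) * (τ * V) := by
    gcongr
    linarith
  nlinarith

lemma nusselt_le (hlx : 0 < lx) (hly : 0 < ly) (S : IsRegularSolution lx ly M u T G)
    (hw : longTimeAverage lx ly (fun t x => ‖u t x 2‖ₑ ^ 2) < ⊤) :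
    nusselt lx ly G ≤
      1 + (1 / 2) * longTimeAverage lx ly (fun t x => ‖u t x 2‖ₑ ^ 2) ^ (1 / 2 : ℝ) := by
  set L := longTimeAverage lx ly (fun t x => ‖u t x 2‖ₑ ^ 2) with hL
  set l := Real.sqrt L.toReal with hl
  have hl0 : 0 ≤ l := Real.sqrt_nonneg _
  have hLl : L = ENNReal.ofReal (l ^ 2) := by
    rw [hl, Real.sq_sqrt ENNReal.toReal_nonneg, ENNReal.ofReal_toReal hw.ne]
  have hroot : L ^ (1 / 2 : ℝ) = ENNReal.ofReal l := by
    rw [hLl, ENNReal.ofReal_rpow_of_nonneg (by positivity) (by positivity), ← Real.sqrt_eq_rpow,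
      Real.sqrt_sq hl0]
  have hrhs : 1 + (1 / 2) * L ^ (1 / 2 : ℝ) = ENNReal.ofReal (1 + l / 2) := by
    rw [hroot, ENNReal.ofReal_add zero_le_one (by positivity), ENNReal.ofReal_one, div_eq_mul_inv l,
      mul_comm l, ENNReal.ofReal_mul (by norm_num), ENNReal.ofReal_inv_of_pos two_pos]
    simp
  rw [hrhs]
  -- Take `s = l + δ` and `ε = δ`. A positive `δ` gives the strict inequality required of `s²`, and
  -- covers the case `l = 0`.
  have hcont : Tendsto (fun δ : ℝ => ENNReal.ofReal
      (1 + (l + δ) / 2 + δ * (2 + 2 * (l + δ) ^ 2))) (𝓝[>] 0) (𝓝 (ENNReal.ofReal (1 + l / 2))) := by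
    have : Continuous fun δ : ℝ => ENNReal.ofReal
      (1 + (l + δ) / 2 + δ * (2 + 2 * (l + δ) ^ 2)) :=
      ENNReal.continuous_ofReal.comp (by fun_prop)
    have h := (this.tendsto 0).mono_left (nhdsWithin_le_nhds (s := Ioi 0))
    simpa using h
  refine ge_of_tendsto hcont ?_
  filter_upwards [self_mem_nhdsWithin] with δ hδ
  rw [mem_Ioi] at hδ
  refine S.nusselt_le_of_lt hlx hly (by linarith) hδ ?_
  rw [← hL, hLl]
  refine (ENNReal.ofReal_lt_ofReal_iff (by positivity)).2 ?_
  nlinarith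

end IsRegularSolution

/-! ### Reduction to regular solutions. -/

lemma ae_ae_of_ae_spaceTime {P : ℝ × Space → Prop} (h : ∀ᵐ p ∂(spaceTimeMeasure lx ly), P p) :
    ∀ᵐ t ∂(volume.restrict (Ioi (0 : ℝ))), ∀ᵐ x ∂(cellMeasure lx ly), P (t, x) :=
  Measure.ae_ae_of_ae_prod h

lemma isSpaceTimeTestFunction_mul {φ : Space → ℝ} (hφ : IsTestFunction lx ly φ) {η : ℝ → ℝ}
    (hη : ContDiff ℝ ∞ η) (hc : HasCompactSupport η) :
    IsSpaceTimeTestFunction lx ly fun t x => η t * φ x := by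
  obtain ⟨⟨h1, h2⟩, δ, hδ, h3⟩ := hφ
  refine ⟨(hη.comp contDiff_fst).mul (h1.comp contDiff_snd), fun t x => ?_,
    ⟨δ, hδ, fun t x hx => by simp only [h3 x hx, mul_zero]⟩, ?_⟩
  · simp only [(h2 x).1, (h2 x).2, and_self]
  · obtain ⟨R, hR⟩ := hc.bddAbove
    refine ⟨R + 1, fun t x ht => ?_⟩
    have : η t = 0 := by
      by_contra hne
      have := hR (subset_tsupport _ hne)
      linarith
    simp only [this, zero_mul]

lemma gradient_const_mul_testFunction {φ : Space → ℝ} (hφ : IsTestFunction lx ly φ) (c : ℝ)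
    (x : Space) : ∇ (fun x => c * φ x) x = c • ∇ φ x := by
  refine HasGradientAt.gradient ?_
  rw [hasGradientAt_iff_hasFDerivAt, map_smul]
  exact ((hφ.contDiff 1).differentiable (by simp) x).hasGradientAt.hasFDerivAt.const_mul c

theorem exists_isRegularSolution (hlx : 0 < lx) (hly : 0 < ly) {u : ℝ → Space → Space}
    (hu_meas : AEStronglyMeasurable (fun p : ℝ × Space => u p.1 p.2) (spaceTimeMeasure lx ly))
    (hu_energy : longTimeAverage lx ly (fun t x => ‖u t x‖ₑ ^ 2) < ⊤)
    (hu_wall : NoPenetration lx ly u) {T₀ : Space → ℝ} {T : ℝ → Space → ℝ}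
    {G : ℝ → Space → Space} (hT : IsWeakSolution lx ly u T₀ T G) :
    ∃ M u' T' G', IsRegularSolution lx ly M u' T' G' ∧
      (∀ᵐ t ∂(volume.restrict (Ioi (0 : ℝ))), ∀ᵐ x ∂(cellMeasure lx ly), u t x = u' t x) ∧
      ∀ᵐ t ∂(volume.restrict (Ioi (0 : ℝ))), ∀ᵐ x ∂(cellMeasure lx ly), G t x = G' t x := by
  obtain ⟨M, hM⟩ : ∃ M : ℝ, ∀ᵐ p ∂(spaceTimeMeasure lx ly), |T p.1 p.2| ≤ M := by
    have h1 := hT.bounded.2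
    rw [eLpNorm_exponent_top] at h1
    refine ⟨(eLpNormEssSup (fun p : ℝ × Space => T p.1 p.2) (spaceTimeMeasure lx ly)).toReal, ?_⟩
    filter_upwards [enorm_ae_le_eLpNormEssSup (fun p : ℝ × Space => T p.1 p.2)
      (spaceTimeMeasure lx ly)] with p hp
    have := ENNReal.toReal_mono h1.ne hp
    simpa using this
  have hM' : ∀ᵐ p ∂(spaceTimeMeasure lx ly), |T p.1 p.2| ≤ |M| :=
    hM.mono fun p hp => hp.trans (le_abs_self M)
  set u' : ℝ → Space → Space := fun t x => hu_meas.mk _ (t, x) with hu'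
  set G' : ℝ → Space → Space := fun t x => hT.grad_meas.mk _ (t, x) with hG'
  -- Clipping the measurable representative makes the bound hold everywhere and changes it only on a
  -- null set.
  set T' : ℝ → Space → ℝ := fun t x => max (-|M|) (min |M| (hT.bounded.1.mk _ (t, x))) with hT'
  have hum : Measurable fun p : ℝ × Space => u' p.1 p.2 := hu_meas.stronglyMeasurable_mk.measurable
  have hGm : Measurable fun p : ℝ × Space => G' p.1 p.2 :=
    hT.grad_meas.stronglyMeasurable_mk.measurable
  have hTm : Measurable fun p : ℝ × Space => T' p.1 p.2 :=
    measurable_const.max (measurable_const.min hT.bounded.1.stronglyMeasurable_mk.measurable)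
  have hue := ae_ae_of_ae_spaceTime (P := fun p => u p.1 p.2 = u' p.1 p.2) hu_meas.ae_eq_mk
  have hGe := ae_ae_of_ae_spaceTime (P := fun p => G p.1 p.2 = G' p.1 p.2) hT.grad_meas.ae_eq_mk
  have hTe := ae_ae_of_ae_spaceTime (P := fun p => T p.1 p.2 = T' p.1 p.2) (by
    filter_upwards [hT.bounded.1.ae_eq_mk, hM'] with p h1 h2
    have h3 := abs_le.1 h2
    simp only [hT']
    rw [← h1, min_eq_right h3.2, max_eq_right h3.1])
  have hTb : ∀ t x, |T' t x| ≤ |M| := fun t x =>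
    abs_le.2 ⟨le_max_left _ _, max_le (by linarith [abs_nonneg M]) (min_le_left _ _)⟩
  have hcongr : ∀ f f' : ℝ → Space → Space, (∀ᵐ t ∂(volume.restrict (Ioi (0 : ℝ))),
      ∀ᵐ x ∂(cellMeasure lx ly), f t x = f' t x) → ∀ τ : ℝ,
      ∫⁻ t in Ioc 0 τ, ∫⁻ x, ‖f t x‖ₑ ^ 2 ∂(cellMeasure lx ly) =
        ∫⁻ t in Ioc 0 τ, ∫⁻ x, ‖f' t x‖ₑ ^ 2 ∂(cellMeasure lx ly) := by
    intro f f' h τ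
    refine lintegral_congr_ae ?_
    filter_upwards [ae_restrict_of_ae_restrict_of_subset
      (Ioc_subset_Ioi_self : Ioc (0 : ℝ) τ ⊆ Ioi 0) h] with t ht
    refine lintegral_congr_ae ?_
    filter_upwards [ht] with x hx
    rw [hx]
  have huL : ∀ τ, MemLp (fun p : ℝ × Space => u' p.1 p.2) 2 (slab lx ly 0 τ) := fun τ =>
    memLp_slab_of_lintegral hum (by
      rw [← hcongr u u' hue τ]
      exact lintegral_slab_lt_top hlx hly hu_energy τ)
  have hGL : ∀ τ, MemLp (fun p : ℝ × Space => G' p.1 p.2) 2 (slab lx ly 0 τ) := fun τ =>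
    memLp_slab_of_lintegral hGm (by
      rw [← hcongr G G' hGe τ]
      exact hT.grad_sq τ)
  refine ⟨|M|, u', T', G', ⟨hum, hTm, hGm, hTb, huL, hGL, ?_, ?_, ?_⟩, hue, hGe⟩
  · filter_upwards [hu_wall, hue] with t h1 h2 φ hφ
    rw [← h1 φ hφ]
    refine integral_congr_ae ?_
    filter_upwards [h2] with x hx
    rw [hx]
  · filter_upwards [hT.dirichlet, hTe, hGe] with t h1 h2 h3
    refine h1.congr ?_ ?_
    · filter_upwards [h2] with x hx
      rw [hx]
    · filter_upwards [h3] with x hx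
      rw [hx]
  · intro φ hφ η hη hηc hηs
    -- The support of `η` in `(0, ∞)` removes the initial term from the weak form.
    have hη0 : η 0 = 0 := by
      by_contra hne
      exact lt_irrefl (0 : ℝ) (hηs (subset_tsupport _ hne))
    have hw := hT.weak_form _ (isSpaceTimeTestFunction_mul hφ hη hηc)
    simp only [hη0, zero_mul, mul_zero, integral_zero, add_zero] at hw
    refine Eq.trans (integral_congr_ae ?_) hw
    filter_upwards [hue, hTe, hGe, ae_memLp_slice hum huL, ae_memLp_slice hGm hGL]
      with t h1 h2 h3 h4 h5
    have hTs : Measurable (T' t) := hTm.comp measurable_prodMk_left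
    have hφ2 : MemLp φ 2 (cellMeasure lx ly) := memLp_of_continuous hφ.continuous 2 lx ly
    have hg2 : MemLp (∇ φ) 2 (cellMeasure lx ly) :=
      memLp_of_continuous hφ.continuous_gradient 2 lx ly
    have hTu : MemLp (fun x => T' t x • u' t x) 2 (cellMeasure lx ly) := by
      refine MemLp.of_le_mul (c := |M|) h4 (hTs.aestronglyMeasurable.smul h4.1)
        (Eventually.of_forall fun x => ?_)
      rw [norm_smul]
      exact mul_le_mul_of_nonneg_right (hTb t x) (norm_nonneg _)
    have i1 : Integrable (fun x => T' t x * φ x) (cellMeasure lx ly) :=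
      (hφ2.integrable one_le_two).bdd_mul hTs.aestronglyMeasurable (Eventually.of_forall (hTb t))
    have i2 : Integrable (fun x => inner ℝ (T' t x • u' t x - G' t x) (∇ φ x))
        (cellMeasure lx ly) := integrable_inner_of_memLp (hTu.sub h5) hg2
    rw [← integral_const_mul, ← integral_const_mul,
      ← integral_add (i1.const_mul _) (i2.const_mul _)]
    refine integral_congr_ae ?_
    filter_upwards [h1, h2, h3] with x hx1 hx2 hx3
    have hd : deriv (fun s => η s * φ x) t = deriv η t * φ x :=
      deriv_mul_const (hη.differentiable (by simp) t) _
    rw [gradient_const_mul_testFunction hφ, hx1, hx2, hx3, hd]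
    simp only [inner_sub_left, real_inner_smul_left, real_inner_smul_right]
    ring

end WallToWall

theorem mainTheorem10 (lx ly : ℝ) (hlx : 0 < lx) (hly : 0 < ly)
    (u : ℝ → WallToWall.Space → WallToWall.Space)
    (hu_meas : AEStronglyMeasurable (fun p : ℝ × WallToWall.Space => u p.1 p.2)
      (WallToWall.spaceTimeMeasure lx ly))
    (hu_energy : WallToWall.longTimeAverage lx ly (fun t x => ‖u t x‖ₑ ^ 2) < ⊤)
    (hu_div : WallToWall.IsDivFree lx ly u)
    (hu_wall : WallToWall.NoPenetration lx ly u)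
    (T₀ : WallToWall.Space → ℝ) (hT₀ : MemLp T₀ ⊤ (WallToWall.cellMeasure lx ly))
    (T : ℝ → WallToWall.Space → ℝ) (G : ℝ → WallToWall.Space → WallToWall.Space)
    (hT : WallToWall.IsWeakSolution lx ly u T₀ T G) :
    WallToWall.nusselt lx ly G ≤
      1 + (1 / 2) * WallToWall.longTimeAverage lx ly (fun t x => ‖u t x 2‖ₑ ^ 2) ^ (1 / 2 : ℝ) := by
  obtain ⟨M, u', T', G', S, hu, hG⟩ :=
    WallToWall.exists_isRegularSolution hlx hly hu_meas hu_energy hu_wall hT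
  have hw : WallToWall.longTimeAverage lx ly (fun t x => ‖u t x 2‖ₑ ^ 2) < ⊤ := by
    refine (WallToWall.longTimeAverage_mono fun t x => ?_).trans_lt hu_energy
    gcongr
    exact enorm_le_iff_norm_le.2 (PiLp.norm_apply_le _ 2)
  have e1 : WallToWall.nusselt lx ly G = WallToWall.nusselt lx ly G' :=
    WallToWall.longTimeAverage_congr (hG.mono fun t ht => ht.mono fun x hx => by rw [hx])
  have e2 : WallToWall.longTimeAverage lx ly (fun t x => ‖u t x 2‖ₑ ^ 2) =
      WallToWall.longTimeAverage lx ly (fun t x => ‖u' t x 2‖ₑ ^ 2) :=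
    WallToWall.longTimeAverage_congr (hu.mono fun t ht => ht.mono fun x hx => by rw [hx])
  rw [e1, e2]
  exact S.nusselt_le hlx hly (e2 ▸ hw)
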